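/- Let $F$ be a field of characteristic $p\ge 0$. Permutations in the symmetric group $S_n$ are composed from left to right, $(i)(\sigma\tau)=((i)\sigma)\tau$, and $\sigma\in S_n$ is identified with the word $(1)\sigma\,(2)\sigma\cdots(n)\sigma$. For $m\ge 0$ let $\omega_m=(1-c_m)(1-c_{m-1})\cdots(1-c_2)\in FS_m$, where $c_i=(i,i-1,\ldots,1)$ is the descending $i$-cycle. Let $q=(q_1,\ldots,q_k)$ be a composition of $n$ with partial sums $q_j^+=q_1+\cdots+q_j$. Put $\Xi^q=\sum_\sigma\sigma\in FS_n$, the sum running over all $\sigma\in S_n$ with $\{i\in[1,n-1]:(i)\sigma>(i+1)\sigma\}\subseteq\{q_1^+,\ldots,q_k^+\}$, put $\omega^q=\omega_{q_1}^{+q_0^+}\omega_{q_2}^{+q_1^+}\cdots\omega_{q_k}^{+q_{k-1}^+}$, where $q_0^+=0$ and $x^{+r}$ denotes $x\in FS_m$ shifted so as to act on $\{r+1,\ldots,r+m\}$, and put $\omega_q=\omega^q\,\Xi^q$. The higher Lie module of $q$ is the right ideal $\mathrm{Lie}_F(q)=\omega_qFS_n$. Let $\lambda=\lambda(q)$ be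 the partition obtained by rearranging the parts of $q$, let $m_i$ be the number of parts of $q$ equal to $i$, and let $q?=\prod_{i\ge1} i^{m_i}\,m_i!$. Let $\Gamma(\lambda)$ be the set of all sequences $T=(T_{n,1},\ldots,T_{n,m_n},\ldots,T_{1,1},\ldots,T_{1,m_1})$ such that each $T_{i,j}$ is a sequence of length $i$ in $[1,n]$, the entries of all the $T_{i,j}$ together form the set $[1,n]$, the first entry of each $T_{i,j}$ is its minimum, and $\min T_{i,1}<\min T_{i,2}<\cdots<\min T_{i,m_i}$ for every $i$. For a word $w=w_1\cdots w_m$ let $Q_w=\omega_m\cdot w$, where $S_m$ acts on words of length $m$ by $\tau\cdot w_1\cdots w_m=w_{(1)\tau}\cdots w_{(m)\tau}$, extended linearly; and for $T\in\Gamma(\lambda)$ let $Q_T=Q_{T_{n,1}}\cdots Q_{T_{n,m_n}}\cdots Q_{T_{1,1}}\cdots Q_{T_{1,m_1}}\in FS_n$, the product being induced by concatenation of words. Theorem. If $q$ is coprime to $p$, that is, $p\nmid q_i$ for all $i$ (no condition when $p=0$), then the elements $\omega_qQ_T$, $T\in\Gamma(\lambda)$, form an $F$-basis of $\mathrm{Lie}_F(q)$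 (in particular they are pairwise distinct). Consequently $\dim_F\mathrm{Lie}_F(q)$ equals the size of the conjugacy class of $S_n$ of cycle type $\lambda$, and this number is $n!/q?$. -/

import Mathlib

/-! # Higher Lie modules of the symmetric groups

Letters and positions `1, …, n` are modelled by `Fin n` (so `i : Fin n` stands for `i + 1`). -/

namespace HigherLie

/-- The symmetric group, with permutations composed from left to right (that is, acting on the
right: `(i)(στ) = ((i)σ)τ`). -/
abbrev Sym (n : ℕ) : Type := (Equiv.Perm (Fin n))ᵐᵒᵖ

instance instFintypeSym (n : ℕ) : Fintype (Sym n) :=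
  Fintype.ofEquiv (Equiv.Perm (Fin n)) MulOpposite.opEquiv

/-- The image `(i)σ`. -/
def app {n : ℕ} (σ : Sym n) (i : Fin n) : Fin n := σ.unop i

theorem app_mul {n : ℕ} (σ τ : Sym n) (i : Fin n) : app (σ * τ) i = app τ (app σ i) := rfl

/-- The group algebra `F S_n`. -/
abbrev GroupAlg (F : Type*) [Field F] (n : ℕ) : Type _ := MonoidAlgebra F (Sym n)

noncomputable section

/-! ### Compositions and partitions -/

/-- `(q, p) = 1`: no part of `q` is divisible by `p`. -/
def IsCoprimeTo {n : ℕ} (q : Composition n) (p : ℕ) : Prop := ∀ i ∈ q.blocks, ¬ p ∣ i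

/-- The partition `λ(q)` obtained by rearranging the parts of `q`. -/
def partitionOf {n : ℕ} (q : Composition n) : Nat.Partition n := Nat.Partition.ofComposition n q

/-- `m_i(λ)`: the number of parts of size `i`. -/
def mult {n : ℕ} (μ : Nat.Partition n) (i : ℕ) : ℕ := μ.parts.count i

/-- `q? = ∏ i, i ^ m_i(q) * m_i(q)!`. -/
def qMark {n : ℕ} (q : Composition n) : ℕ :=
  ∏ i ∈ Finset.Icc 1 n, i ^ (q.blocks.count i) * (q.blocks.count i).factorial

/-- The permutations in `S_n` of cycle type `μ` (fixed points counted as parts of size `1`). -/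
def conjClass {n : ℕ} (μ : Nat.Partition n) : Set (Equiv.Perm (Fin n)) :=
  {σ | σ.partition.parts = μ.parts}

/-! ### The elements `Ξ^q`, `ω_n` and `ω_q` -/

/-- The descent set: all `i ∈ [1, n - 1]` with `(i)σ > (i + 1)σ` (in the `1`-based numbering). -/
def Des {n : ℕ} (σ : Sym n) : Set ℕ :=
  {i | ∃ (h0 : 0 < i) (hn : i < n), app σ ⟨i, hn⟩ < app σ ⟨i - 1, by omega⟩}

open scoped Classical in
/-- Solomon's descent element `Ξ^q`: the sum of all permutations whose descents are among the
partial sums `q_1 + ⋯ + q_j`, `1 ≤ j ≤ ℓ(q)`. -/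
def descentElt (F : Type*) [Field F] {n : ℕ} (q : Composition n) : GroupAlg F n :=
  ∑ σ : Sym n with Des σ ⊆ {i | ∃ j, 1 ≤ j ∧ j ≤ q.length ∧ i = q.sizeUpTo j},
    MonoidAlgebra.single σ 1

/-- The descending cycle `c_{k+1} = (k + 1, k, …, 1)` of length `k + 1` (in `1`-based numbering);
`Fin.cycleRange k` is the ascending cycle on the same letters. -/
def descCycle {m : ℕ} (k : Fin m) : Sym m := MulOpposite.op (Fin.cycleRange k)⁻¹

/-- The Dynkin–Specht–Wever element `ω_m = (1 - c_m)(1 - c_{m-1}) ⋯ (1 - c_2)`. -/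
def wever (F : Type*) [Field F] (m : ℕ) : GroupAlg F m :=
  (((List.finRange m).filter (fun k => 0 < k.val)).reverse.map
    fun k => (1 - MonoidAlgebra.single (descCycle k) 1 : GroupAlg F m)).prod

/-- The shift `x ↦ x^{+r}`, `r = q_1 + ⋯ + q_{i-1}`, from `F S_{q_i}` to `F S_n`: it lets a
permutation of the `q_i` letters act on the `i`-th block `[r + 1, r + q_i]` of `[1, n]` and fix all
other letters. -/
def blockShift (F : Type*) [Field F] {n : ℕ} (q : Composition n) (i : Fin q.length) :
    GroupAlg F (q.blocksFun i) →ₐ[F] GroupAlg F n :=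
  MonoidAlgebra.mapDomainAlgHom F F
    (MonoidHom.op (Equiv.Perm.viaEmbeddingHom (q.embedding i).toEmbedding))

/-- `ω^q`: the product over the blocks of `q` of the shifted elements `ω_{q_i}`. -/
def weverYoung (F : Type*) [Field F] {n : ℕ} (q : Composition n) : GroupAlg F n :=
  (List.ofFn fun i : Fin q.length => blockShift F q i (wever F (q.blocksFun i))).prod

/-- `ω_q = ω^q Ξ^q`. -/
def higherWever (F : Type*) [Field F] {n : ℕ} (q : Composition n) : GroupAlg F n :=
  weverYoung F q * descentElt F q

/-- The higher Lie module `Lie_F(q) = ω_q F S_n`, the right ideal of `F S_n` generated by `ω_q`. -/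
def lieModule (F : Type*) [Field F] {n : ℕ} (q : Composition n) :
    Submodule (GroupAlg F n)ᵐᵒᵖ (GroupAlg F n) :=
  Submodule.span (GroupAlg F n)ᵐᵒᵖ {higherWever F q}

/-! ### Words -/

/-- The algebra of words in the letters `1, …, n`, with concatenation as product. -/
abbrev WordAlg (F : Type*) [Field F] (n : ℕ) : Type _ := MonoidAlgebra F (FreeMonoid (Fin n))

/-- The word `w_1 w_2 ⋯ w_m`. -/
def wordOf {m n : ℕ} (w : Fin m → Fin n) : FreeMonoid (Fin n) := FreeMonoid.ofList (List.ofFn w)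

/-- `Q_w = ω_m · w`, for the linear extension of the Pólya action
`τ · w_1 ⋯ w_m = w_{(1)τ} ⋯ w_{(m)τ}` of `S_m` on words of length `m`. -/
def lieWord (F : Type*) [Field F] {m n : ℕ} (w : Fin m → Fin n) : WordAlg F n :=
  MonoidAlgebra.mapDomain (fun τ : Sym m => wordOf fun i => w (app τ i)) (wever F m)

/-- Identification of the words `w_1 ⋯ w_n` with `{w_1, …, w_n} = {1, …, n}` with the permutations
`i ↦ w_i`: the coefficient of `σ` is the coefficient of the word `(1)σ ⋯ (n)σ`. -/
def toGroupAlg {F : Type*} [Field F] {n : ℕ} (x : WordAlg F n) : GroupAlg F n :=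
  MonoidAlgebra.ofCoeff (Finsupp.equivFunOnFinite.symm fun σ : Sym n => x.coeff (wordOf (app σ)))

/-! ### The index set `Γ(λ)` and the elements `Q_T` -/

/-- `Γ(μ)`: families `T_{i,j}` (`1 ≤ j ≤ m_i(μ)`) of sequences of length `i` whose entries fill
`[1, n]`, each of which begins with its minimum, and such that these minima increase with `j` for
each fixed `i`. -/
structure Gamma {n : ℕ} (μ : Nat.Partition n) where
  /-- the sequences `T_{i,j}` -/
  seq : (i : ℕ) → Fin (mult μ i) → Fin i → Fin n
  /-- together the entries are `1, …, n` -/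
  cover : ∀ x : Fin n, ∃ i j k, seq i j k = x
  /-- `min T_{i,j}` is the first entry -/
  min_first : ∀ (i : ℕ) (hi : 0 < i) (j : Fin (mult μ i)),
    IsLeast (Set.range (seq i j)) (seq i j ⟨0, hi⟩)
  /-- `min T_{i,1} < min T_{i,2} < ⋯` -/
  min_lt : ∀ (i : ℕ) (hi : 0 < i) (j j' : Fin (mult μ i)), j < j' →
    seq i j ⟨0, hi⟩ < seq i j' ⟨0, hi⟩

/-- `Q_T = Q_{T_{n,1}} ⋯ Q_{T_{n,m_n}} ⋯ Q_{T_{1,1}} ⋯ Q_{T_{1,m_1}}`, as an element of `F S_n`. -/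
def lieTableau (F : Type*) [Field F] {n : ℕ} {μ : Nat.Partition n} (T : Gamma μ) :
    GroupAlg F n :=
  toGroupAlg (((List.range' 1 n).reverse.flatMap fun i =>
    (List.finRange (mult μ i)).map fun j => lieWord F (T.seq i j)).prod)

end

end HigherLie

/-!
The group algebra `F S_n` is embedded into the free associative algebra on the letters `1, …, n` by
reading a permutation as a word (`toWords`). Multiplication from the left by elements of `F S_n`
becomes a place action, and in this guise the elements of the theorem have a transparent meaning:
`ω_m` sends a word to its left-normed bracketing (`polya_wever`), and `ω_q` is the convolution
product of the bracketing operators of degrees `q_1, …, q_k` with respect to the unshuffle coproduct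
(`polya_higherWever`): it distributes the letters of a word over `k` subwords of lengths `q_j`,
brackets each of them, and multiplies.

Each row of a tableau `T` contributes a Lie monomial to `Q_T`, and Lie monomials are primitive
(`coprod_bracketing`). As there are exactly `k` rows and no `q_j` vanishes, in the coproduct of
`Q_T` only those terms matter in which every tensor factor receives exactly one row, of the right
degree; there the Dynkin–Specht–Wever theorem (`bracketingLin_bracketing`) produces the factor
`q_j`. Hence `ω_q Q_T` is `q_1 ⋯ q_k` times the symmetrised product of the rows of `T`
(`toWords_higherWever_mul_lieTableau`), and the scalar is invertible because `q` is coprime to the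
characteristic.

*Independence.* The bracketing of a word `w` beginning with its minimum is `w` plus words beginning
with other letters. So the coefficient of the symmetrised product of `T` at the word obtained by
writing the rows of `T'` one after another is `1` if `T = T'` and `0` otherwise
(`wordCoeff_symTableau`).

*Spanning.* The value of `ω_q` at a permutation is a sum over all ways to distribute its letters
over `k` subwords. The symmetric group on `{1, …, k}` acts freely on these, and the sum over each
orbit is a symmetrised product (`convBracketing_word_mem`). The latter is multilinear in the Lie
monomials, each of which is a combination of bracketings of words beginning with their minima
(`bracketing_mem_span_head`); sorting the rows turns what results into tableaux. No division by
`m_i!` is needed, which is why the argument works in every characteristic coprime to the parts.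

*Dimension.* Every filling of the rows with the letters `1, …, n` arises from exactly one tableau by
permuting rows of equal length and rotating each row (`card_gamma_mul`), so the number of tableaux
is `n!/q?`; this is also the size of the conjugacy class, by Mathlib's formula.
-/

namespace HigherLie

noncomputable section

/-! ### Words and left-normed bracketings -/

/-- The free associative algebra on `X`: `WordAlg F n` for an arbitrary alphabet. -/
abbrev FreeAlg (F X : Type*) [Field F] : Type _ := MonoidAlgebra F (FreeMonoid X)

section Bracketing

variable {F : Type*} [Field F] {X : Type*}

/-- The linear map on a monoid algebra with prescribed values on the monoid. -/
def linExt {M V : Type*} [AddCommGroup V] [Module F V] (f : M → V) :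
    MonoidAlgebra F M →ₗ[F] V :=
  (MonoidAlgebra.basis M F).constr F f

@[simp]
theorem linExt_single {M V : Type*} [AddCommGroup V] [Module F V] (f : M → V) (m : M) :
    linExt (F := F) f (MonoidAlgebra.single m 1) = f m := by
  have h := (MonoidAlgebra.basis M F).constr_basis F f m
  rwa [MonoidAlgebra.basis_apply] at h

theorem linearMap_ext_single {M V : Type*} [AddCommGroup V] [Module F V]
    {f g : MonoidAlgebra F M →ₗ[F] V}
    (h : ∀ m, f (MonoidAlgebra.single m 1) = g (MonoidAlgebra.single m 1)) : f = g :=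
  (MonoidAlgebra.basis M F).ext fun m => by simpa [MonoidAlgebra.basis_apply] using h m

variable (F) in
/-- The word `l`, as an element of the free algebra. -/
def word (l : List X) : FreeAlg F X := MonoidAlgebra.single (FreeMonoid.ofList l) 1

@[simp]
theorem word_nil : word F ([] : List X) = 1 := rfl

theorem word_append (l l' : List X) : word F (l ++ l') = word F l * word F l' := by
  simp [word, MonoidAlgebra.single_mul_single]

theorem word_cons (x : X) (l : List X) : word F (x :: l) = word F [x] * word F l :=
  word_append [x] l

theorem word_flatten (L : List (List X)) : word F L.flatten = (L.map (word F)).prod := by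
  induction L with
  | nil => rfl
  | cons l L ih => simp [word_append, ih]

theorem linearMap_ext_word {V : Type*} [AddCommGroup V] [Module F V] {f g : FreeAlg F X →ₗ[F] V}
    (h : ∀ l, f (word F l) = g (word F l)) : f = g :=
  linearMap_ext_single fun m => h m.toList

@[simp]
theorem linExt_word {V : Type*} [AddCommGroup V] [Module F V] (f : FreeMonoid X → V) (l : List X) :
    linExt f (word F l) = f (FreeMonoid.ofList l) :=
  linExt_single f _

variable (F) in
/-- The left-normed bracketing `[…[[x₁, x₂], x₃], …, x_m]` of the word `x₁ x₂ ⋯ x_m`; the empty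
word is sent to `1`. -/
def bracketing : List X → FreeAlg F X
  | [] => 1
  | x :: l => l.foldl (fun P y => P * word F [y] - word F [y] * P) (word F [x])

@[simp]
theorem bracketing_nil : bracketing F ([] : List X) = 1 := rfl

@[simp]
theorem bracketing_singleton (x : X) : bracketing F [x] = word F [x] := rfl

theorem bracketing_concat {l : List X} (hl : l ≠ []) (y : X) :
    bracketing F (l ++ [y]) = bracketing F l * word F [y] - word F [y] * bracketing F l := by
  cases l with
  | nil => exact absurd rfl hl
  | cons x l => simp [bracketing, List.foldl_append]

variable (F) in
/-- The linear extension of `bracketing` to the free algebra. -/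
def bracketingLin : FreeAlg F X →ₗ[F] FreeAlg F X := linExt fun m => bracketing F m.toList

@[simp]
theorem bracketingLin_word (l : List X) : bracketingLin F (word F l) = bracketing F l := by
  simp [bracketingLin]

variable (F X) in
/-- The augmentation of the free algebra, sending every letter to `0`. -/
def augmentation : FreeAlg F X →ₐ[F] F :=
  MonoidAlgebra.lift F F (FreeMonoid X) (FreeMonoid.lift fun _ => 0)

@[simp]
theorem augmentation_letter (x : X) : augmentation F X (word F [x]) = 0 := by
  simp [augmentation, word]

theorem augmentation_word {l : List X} (hl : l ≠ []) : augmentation F X (word F l) = 0 := by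
  cases l with
  | nil => exact absurd rfl hl
  | cons x l => rw [word_cons, map_mul, augmentation_letter, zero_mul]

theorem augmentation_bracketing {l : List X} (hl : l ≠ []) :
    augmentation F X (bracketing F l) = 0 := by
  induction l using List.reverseRecOn with
  | nil => exact absurd rfl hl
  | append_singleton l y ih =>
    rcases eq_or_ne l [] with rfl | hl
    · simp
    · simp [bracketing_concat hl]

theorem bracketingLin_mul_letter (y : FreeAlg F X) (x : X) :
    bracketingLin F (y * word F [x]) = bracketingLin F y * word F [x]
      - word F [x] * bracketingLin F y + augmentation F X y • word F [x] := by
  have h : bracketingLin F ∘ₗ LinearMap.mulRight F (word F [x])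
      = LinearMap.mulRight F (word F [x]) ∘ₗ bracketingLin F
        - LinearMap.mulLeft F (word F [x]) ∘ₗ bracketingLin F
        + (augmentation F X).toLinearMap.smulRight (word F [x]) := by
    refine linearMap_ext_word fun l => ?_
    rcases eq_or_ne l [] with rfl | hl
    · have := bracketingLin_word (F := F) ([] : List X)
      simp only [word_nil, bracketing_nil] at this
      simp [this]
    · simp [← word_append, bracketing_concat hl, augmentation_word hl]
  exact LinearMap.congr_fun h y

/-- Bracketing after a left factor: a left-normed bracketing of `y P` with `P` a Lie monomial
is the commutator of the bracketing of `y` with `P`, as far as `y` has no constant term. -/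
theorem bracketingLin_mul_bracketing (y : FreeAlg F X) {l : List X} (hl : l ≠ []) :
    bracketingLin F (y * bracketing F l) = bracketingLin F y * bracketing F l
      - bracketing F l * bracketingLin F y
      + augmentation F X y • bracketingLin F (bracketing F l) := by
  induction l using List.reverseRecOn generalizing y with
  | nil => exact absurd rfl hl
  | append_singleton l x ih =>
    rcases eq_or_ne l [] with rfl | hl
    · simp [bracketingLin_mul_letter]
    · have h1 := ih (word F [x]) hl
      have h2 := ih (y * word F [x]) hl
      have h3 := ih y hl
      simp only [augmentation_letter, zero_smul, add_zero, bracketingLin_word,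
        bracketing_singleton] at h1
      simp only [map_mul, augmentation_letter, mul_zero, zero_smul, add_zero,
        bracketingLin_mul_letter] at h2
      simp only [bracketing_concat hl, mul_sub, map_sub, ← mul_assoc, bracketingLin_mul_letter, h1,
        h2, h3, map_mul, augmentation_bracketing hl, mul_zero, zero_smul, add_zero]
      simp only [mul_sub, sub_mul, mul_add, add_mul, mul_assoc, smul_sub, smul_mul_assoc,
        mul_smul_comm]
      abel

/-- The Dynkin–Specht–Wever theorem for Lie monomials. -/
theorem bracketingLin_bracketing {l : List X} (hl : l ≠ []) :
    bracketingLin F (bracketing F l) = (l.length : F) • bracketing F l := by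
  induction l using List.reverseRecOn with
  | nil => exact absurd rfl hl
  | append_singleton l x ih =>
    rcases eq_or_ne l [] with rfl | hl
    · simp
    · simp only [bracketing_concat hl, map_sub, bracketingLin_mul_letter,
        bracketingLin_mul_bracketing _ hl, ih hl, augmentation_bracketing hl]
      simp only [bracketingLin_word, bracketing_singleton, augmentation_letter, zero_smul,
        add_zero, List.length_append, List.length_singleton, Nat.cast_add, Nat.cast_one,
        smul_mul_assoc, mul_smul_comm, add_smul, one_smul, smul_sub]
      abel

/-- A Lie monomial is multilinear: it only involves rearrangements of its letters. -/
theorem bracketing_mem_span_perm (l : List X) :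
    bracketing F l ∈ Submodule.span F (word F '' {v | v.Perm l}) := by
  induction l using List.reverseRecOn with
  | nil => exact Submodule.subset_span ⟨[], by simp⟩
  | append_singleton l x ih =>
    rcases eq_or_ne l [] with rfl | hl
    · exact Submodule.subset_span ⟨[x], by simp⟩
    · rw [bracketing_concat hl]
      refine Submodule.sub_mem _ ?_ ?_
      · have := Submodule.mem_map_of_mem (f := LinearMap.mulRight F (word F [x])) ih
        rw [Submodule.map_span, ← Set.image_comp] at this
        refine Submodule.span_mono ?_ this
        rintro _ ⟨v, hv, rfl⟩
        exact ⟨v ++ [x], List.Perm.append_right _ hv, by simp [word_append]⟩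
      · have := Submodule.mem_map_of_mem (f := LinearMap.mulLeft F (word F [x])) ih
        rw [Submodule.map_span, ← Set.image_comp] at this
        refine Submodule.span_mono ?_ this
        rintro _ ⟨v, hv, rfl⟩
        exact ⟨x :: v, ((List.Perm.cons x hv).trans (List.perm_append_singleton x l).symm),
          by simp [word_cons x v]⟩

/-- The Dynkin spanning set: a Lie monomial is a combination of left-normed ones that begin with a
given one of its letters. -/
theorem bracketing_mem_span_head {l : List X} {a : X} (ha : a ∈ l) :
    bracketing F l ∈
      Submodule.span F ((fun v => bracketing F (a :: v)) '' {v | (a :: v).Perm l}) := by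
  induction l using List.reverseRecOn with
  | nil => simp at ha
  | append_singleton l x ih =>
    rcases eq_or_ne l [] with rfl | hl
    · obtain rfl : a = x := by simpa using ha
      exact Submodule.subset_span ⟨[], by simp⟩
    by_cases hal : a ∈ l
    · have := Submodule.mem_map_of_mem (f := LinearMap.mulRight F (word F [x])
        - LinearMap.mulLeft F (word F [x])) (ih hal)
      rw [Submodule.map_span, ← Set.image_comp] at this
      rw [bracketing_concat hl]
      refine Submodule.span_mono ?_ this
      rintro _ ⟨v, hv, rfl⟩
      refine ⟨v ++ [x], List.Perm.append_right [x] hv, ?_⟩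
      exact bracketing_concat (List.cons_ne_nil a v) x
    · obtain rfl : a = x := by simpa [hal] using ha
      have h1 := bracketingLin_mul_bracketing (F := F) (word F [a]) hl
      simp only [bracketingLin_word, bracketing_singleton, augmentation_letter, zero_smul,
        add_zero] at h1
      -- `[P, a] = -[a, P]`, and `[a, P]` is the bracketing of the words occurring in `a P`
      rw [bracketing_concat hl, ← neg_sub, ← h1]
      refine Submodule.neg_mem _ ?_
      have := Submodule.mem_map_of_mem
        (f := bracketingLin F ∘ₗ LinearMap.mulLeft F (word F [a]))
        (bracketing_mem_span_perm (F := F) l)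
      rw [Submodule.map_span, ← Set.image_comp] at this
      refine Submodule.span_mono ?_ this
      rintro _ ⟨v, hv, rfl⟩
      exact ⟨v, (List.Perm.cons a hv).trans (List.perm_append_singleton a l).symm,
        by simp [← word_cons]⟩

variable (F) in
/-- The coefficient of the word `u`. -/
def wordCoeff (u : List X) : FreeAlg F X →ₗ[F] F :=
  Finsupp.lapply (FreeMonoid.ofList u) ∘ₗ (MonoidAlgebra.coeffLinearEquiv F).toLinearMap

theorem wordCoeff_apply (u : List X) (x : FreeAlg F X) :
    wordCoeff F u x = x.coeff (FreeMonoid.ofList u) := rfl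

theorem wordCoeff_word [DecidableEq X] (u l : List X) :
    wordCoeff F u (word F l) = if l = u then 1 else 0 := by
  classical
  rw [wordCoeff_apply, word, MonoidAlgebra.coeff_single, Finsupp.single_apply]
  simp

/-- Triangularity: apart from `a l` itself, the words occurring in the bracketing of `a l` do not
begin with `a`. -/
theorem bracketing_sub_word_mem {a : X} {l : List X} (ha : a ∉ l) :
    bracketing F (a :: l) - word F (a :: l) ∈
      Submodule.span F (word F '' {v | ∃ b u, b ≠ a ∧ v = b :: u}) := by
  induction l using List.reverseRecOn with
  | nil => simp
  | append_singleton l x ih =>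
    simp only [List.mem_append, List.mem_singleton, not_or] at ha
    have hx : x ≠ a := fun h => ha.2 h.symm
    have h := ih ha.1
    rw [← List.cons_append, bracketing_concat (List.cons_ne_nil a l), word_append (a :: l),
      sub_right_comm, ← sub_mul]
    refine Submodule.sub_mem _ ?_ ?_
    · have := Submodule.mem_map_of_mem (f := LinearMap.mulRight F (word F [x])) h
      rw [Submodule.map_span, ← Set.image_comp] at this
      refine Submodule.span_mono ?_ this
      rintro _ ⟨_, ⟨b, u, hb, rfl⟩, rfl⟩
      exact ⟨b :: (u ++ [x]), ⟨b, _, hb, rfl⟩, by simp [← word_append]⟩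
    · have := Submodule.mem_map_of_mem (f := LinearMap.mulLeft F (word F [x]))
        (bracketing_mem_span_perm (F := F) (a :: l))
      rw [Submodule.map_span, ← Set.image_comp] at this
      refine Submodule.span_mono ?_ this
      rintro _ ⟨v, -, rfl⟩
      exact ⟨x :: v, ⟨x, _, hx, rfl⟩, by simp [word_cons x v]⟩

theorem wordCoeff_bracketing_cons [DecidableEq X] {a : X} {l : List X} (u : List X) (ha : a ∉ l) :
    wordCoeff F (a :: u) (bracketing F (a :: l)) = if l = u then 1 else 0 := by
  have h : Submodule.span F (word F '' {v | ∃ b u, b ≠ a ∧ v = b :: u}) ≤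
      LinearMap.ker (wordCoeff F (a :: u)) := by
    rw [Submodule.span_le]
    rintro _ ⟨_, ⟨b, v, hb, rfl⟩, rfl⟩
    simp [wordCoeff_word, hb]
  have h1 : wordCoeff F (a :: u) _ = 0 := h (bracketing_sub_word_mem (F := F) ha)
  rw [map_sub, sub_eq_zero] at h1
  simp [h1, wordCoeff_word]

theorem wordCoeff_bracketing_eq_zero {l u : List X} (hu : ¬ u.Perm l) :
    wordCoeff F u (bracketing F l) = 0 := by
  classical
  have h : Submodule.span F (word F '' {v | v.Perm l}) ≤ LinearMap.ker (wordCoeff F u) := by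
    rw [Submodule.span_le]
    rintro _ ⟨v, hv, rfl⟩
    have : v ≠ u := by rintro rfl; exact hu hv
    simp [wordCoeff_word, this]
  exact h (bracketing_mem_span_perm l)

/-- Coefficients are multiplicative when the left factor is homogeneous of the right degree. -/
theorem wordCoeff_mul_append {u v : List X} {x : FreeAlg F X} (y : FreeAlg F X)
    (hx : x ∈ Submodule.span F (word F '' {w | w.length = u.length})) :
    wordCoeff F (u ++ v) (x * y) = wordCoeff F u x * wordCoeff F v y := by
  classical
  induction hx using Submodule.span_induction with
  | mem x hx =>
    obtain ⟨w, hw, rfl⟩ := hx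
    have h : wordCoeff F (u ++ v) ∘ₗ LinearMap.mulLeft F (word F w)
        = wordCoeff F u (word F w) • wordCoeff F v := by
      refine linearMap_ext_word fun l => ?_
      have : (w ++ l = u ++ v) ↔ (w = u ∧ l = v) :=
        ⟨fun h => List.append_inj h hw, by rintro ⟨rfl, rfl⟩; rfl⟩
      by_cases h1 : w = u <;> by_cases h2 : l = v <;>
        simp [← word_append, wordCoeff_word, this, h1, h2]
    exact LinearMap.congr_fun h y
  | zero => simp
  | add x z _ _ hx hz => simp [add_mul, hx, hz]
  | smul c x _ hx => simp [hx, mul_assoc]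

theorem wordCoeff_flatten_prod {ι : Type*} (L : List ι) {x : ι → FreeAlg F X} {u : ι → List X}
    (hL : ∀ i ∈ L, x i ∈ Submodule.span F (word F '' {w | w.length = (u i).length})) :
    wordCoeff F (L.map u).flatten (L.map x).prod =
      (L.map fun i => wordCoeff F (u i) (x i)).prod := by
  induction L with
  | nil =>
    classical
    rw [List.map_nil, List.map_nil, List.prod_nil, List.flatten_nil, ← word_nil, wordCoeff_word]
    simp
  | cons i L ih =>
    simp only [List.map_cons, List.prod_cons, List.flatten_cons]
    rw [wordCoeff_mul_append _ (hL i (by simp)), ih fun j hj => hL j (by simp [hj])]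

theorem bracketing_mem_span_length (l : List X) :
    bracketing F l ∈ Submodule.span F (word F '' {w | w.length = l.length}) :=
  Submodule.span_mono (Set.image_mono fun _ hv => hv.length_eq) (bracketing_mem_span_perm l)

end Bracketing

/-! ### Convolution products of Dynkin operators -/

section Convolution

variable {F : Type*} [Field F] {X : Type*}

theorem multilinear_apply_mem_of_mem_span {ι M N : Type*} [Fintype ι] [AddCommGroup M]
    [Module F M] [AddCommGroup N] [Module F N] (f : MultilinearMap F (fun _ : ι => M) N)
    {B : ι → Set M} {W : Submodule F N} (h : ∀ v, (∀ i, v i ∈ B i) → f v ∈ W) {x : ι → M}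
    (hx : ∀ i, x i ∈ Submodule.span F (B i)) : f x ∈ W := by
  classical
  suffices H : ∀ s : Finset ι, ∀ x : ι → M, (∀ i ∈ s, x i ∈ Submodule.span F (B i)) →
      (∀ i ∉ s, x i ∈ B i) → f x ∈ W from
    H Finset.univ x (fun i _ => hx i) fun i hi => absurd (Finset.mem_univ i) hi
  intro s
  induction s using Finset.induction_on with
  | empty => exact fun x _ hx => h x fun i => hx i (by simp)
  | insert i s his ih =>
    intro x h1 h2
    have key : ∀ y ∈ Submodule.span F (B i), f (Function.update x i y) ∈ W := by
      intro y hy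
      induction hy using Submodule.span_induction with
      | mem y hy =>
        refine ih _ (fun j hj => ?_) fun j hj => ?_
        · have : j ≠ i := by rintro rfl; exact his hj
          rw [Function.update_of_ne this]
          exact h1 j (Finset.mem_insert_of_mem hj)
        · rcases eq_or_ne j i with rfl | hji
          · simpa using hy
          · rw [Function.update_of_ne hji]
            exact h2 j (by simp [hji, hj])
      | zero => simp
      | add y z _ _ hy hz => rw [f.map_update_add]; exact W.add_mem hy hz
      | smul c y _ hy => rw [f.map_update_smul]; exact W.smul_mem c hy
    simpa using key (x i) (h1 i (Finset.mem_insert_self i s))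

variable (F X) in
/-- The algebra of `k`-tuples of words with componentwise concatenation, a concrete model of the
`k`-th tensor power of the free algebra. -/
abbrev TupleAlg (k : ℕ) : Type _ := MonoidAlgebra F (Fin k → FreeMonoid X)

/-- The embedding of the free algebra as the `j`-th tensor factor. -/
def place {k : ℕ} (j : Fin k) : FreeAlg F X →ₐ[F] TupleAlg F X k :=
  MonoidAlgebra.mapDomainAlgHom F F (MonoidHom.mulSingle (fun _ : Fin k => FreeMonoid X) j)

theorem place_word {k : ℕ} (j : Fin k) (l : List X) :
    place j (word F l) = MonoidAlgebra.single (Pi.mulSingle j (FreeMonoid.ofList l)) 1 := by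
  simp [place, word]

theorem commute_place {k : ℕ} {i j : Fin k} (hij : i ≠ j) (x y : FreeAlg F X) :
    Commute (place i x) (place j y) := by
  have h : (LinearMap.mul F (TupleAlg F X k)).compl₁₂ (place i).toLinearMap (place j).toLinearMap
      = ((LinearMap.mul F (TupleAlg F X k)).compl₁₂ (place j).toLinearMap
          (place i).toLinearMap).flip := by
    refine linearMap_ext_word fun l => linearMap_ext_word fun l' => ?_
    have := (Pi.mulSingle_commute (f := fun _ : Fin k => FreeMonoid X) hij (FreeMonoid.ofList l)
      (FreeMonoid.ofList l')).eq
    simp [place_word, MonoidAlgebra.single_mul_single, this]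
  exact LinearMap.congr_fun₂ h x y

variable (F X) in
/-- The `k`-fold unshuffle coproduct, for which the letters are primitive. -/
def coprod (k : ℕ) : FreeAlg F X →ₐ[F] TupleAlg F X k :=
  MonoidAlgebra.lift F _ (FreeMonoid X) (FreeMonoid.lift fun x => ∑ j, place j (word F [x]))

theorem coprod_letter (k : ℕ) (x : X) :
    coprod F X k (word F [x]) = ∑ j, place j (word F [x]) := by
  simp [coprod, word]

/-- Lie monomials are primitive. -/
theorem coprod_bracketing (k : ℕ) {l : List X} (hl : l ≠ []) :
    coprod F X k (bracketing F l) = ∑ j, place j (bracketing F l) := by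
  induction l using List.reverseRecOn with
  | nil => exact absurd rfl hl
  | append_singleton l x ih =>
    rcases eq_or_ne l [] with rfl | hl
    · simp [coprod_letter]
    · simp only [bracketing_concat hl, map_sub, map_mul, ih hl, coprod_letter, Finset.sum_mul_sum,
        Finset.sum_sub_distrib]
      have h2 : ∑ i : Fin k, ∑ j, place i (word F [x]) * place j (bracketing F l)
          = ∑ j : Fin k, ∑ i, place i (word F [x]) * place j (bracketing F l) := Finset.sum_comm
      rw [h2, ← Finset.sum_sub_distrib, ← Finset.sum_sub_distrib]
      refine Finset.sum_congr rfl fun i _ => ?_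
      rw [← Finset.sum_sub_distrib, Finset.sum_eq_single i]
      · intro j _ hj
        rw [(commute_place hj.symm _ _).eq, sub_self]
      · simp

variable (F X) in
/-- The tensor product of the bracketing operators on the homogeneous components of degrees
`d 0, …, d (k - 1)` (and zero on the other components), followed by multiplication. -/
def tupleBracketing {k : ℕ} (d : Fin k → ℕ) : TupleAlg F X k →ₗ[F] FreeAlg F X :=
  linExt fun u => if ∀ j, (u j).length = d j then
    (List.ofFn fun j => bracketing F (u j).toList).prod else 0

variable (F X) in
/-- The convolution product of the bracketing operators of degrees `d 0, …, d (k - 1)`: the sum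
over all ways to distribute the letters of a word over `k` subwords of lengths `d j`, which are
then bracketed and multiplied. -/
def convBracketing {k : ℕ} (d : Fin k → ℕ) : FreeAlg F X →ₗ[F] FreeAlg F X :=
  tupleBracketing F X d ∘ₗ (coprod F X k).toLinearMap

theorem prod_ofFn_sum {A : Type*} [Ring A] [Algebra F A] {m : ℕ} {κ : Type*} [Fintype κ]
    (x : Fin m → κ → A) : (List.ofFn fun i => ∑ j, x i j).prod
      = ∑ g : Fin m → κ, (List.ofFn fun i => x i (g i)).prod := by
  classical
  have := (MultilinearMap.mkPiAlgebraFin F m A).map_sum (α := fun _ => κ) x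
  simpa using this

theorem prod_ofFn_single {M : Type*} [Monoid M] {m : ℕ} (u : Fin m → M) :
    (List.ofFn fun i => (MonoidAlgebra.single (u i) 1 : MonoidAlgebra F M)).prod
      = MonoidAlgebra.single (List.ofFn u).prod 1 := by
  have := map_list_prod (MonoidAlgebra.of F M) (List.ofFn u)
  rw [List.map_ofFn] at this
  exact this.symm

theorem prod_ofFn_smul {A : Type*} [Ring A] [Algebra F A] {m : ℕ} (c : Fin m → F) (x : Fin m → A) :
    (List.ofFn fun i => c i • x i).prod = (∏ i, c i) • (List.ofFn x).prod := by
  simpa using (MultilinearMap.mkPiAlgebraFin F m A).map_smul_univ c x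

/-- `tupleBracketing` on an ordered product of elements placed in the factors `g i`, as a
multilinear map. -/
def tupleBracketingPlace {k m : ℕ} (d : Fin k → ℕ) (g : Fin m → Fin k) :
    MultilinearMap F (fun _ : Fin m => FreeAlg F X) (FreeAlg F X) :=
  (tupleBracketing F X d).compMultilinearMap
    ((MultilinearMap.mkPiAlgebraFin F m (TupleAlg F X k)).compLinearMap
      fun i => (place (g i)).toLinearMap)

theorem tupleBracketingPlace_apply {k m : ℕ} (d : Fin k → ℕ) (g : Fin m → Fin k)
    (x : Fin m → FreeAlg F X) : tupleBracketingPlace d g x =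
      tupleBracketing F X d (List.ofFn fun i => place (g i) (x i)).prod := rfl

theorem tupleBracketingPlace_word {k m : ℕ} (d : Fin k → ℕ) (g : Fin m → Fin k)
    (u : Fin m → List X) : tupleBracketingPlace d g (fun i => word F (u i)) =
      tupleBracketing F X d (MonoidAlgebra.single
        (List.ofFn fun i => Pi.mulSingle (g i) (FreeMonoid.ofList (u i))).prod 1) := by
  simp only [tupleBracketingPlace_apply, place_word, prod_ofFn_single]

theorem multilinear_ext_word {V : Type*} [AddCommGroup V] [Module F V] {m : ℕ}
    {f g : MultilinearMap F (fun _ : Fin m => FreeAlg F X) V}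
    (h : ∀ u : Fin m → List X, f (fun i => word F (u i)) = g fun i => word F (u i)) : f = g :=
  Module.Basis.ext_multilinear (fun _ => MonoidAlgebra.basis (FreeMonoid X) F) fun v => by
    simp only [MonoidAlgebra.basis_apply]
    exact h fun i => (v i).toList

theorem prod_ofFn_apply {k m : ℕ} {M : Type*} [Monoid M] (u : Fin m → Fin k → M) (j : Fin k) :
    (List.ofFn u).prod j = (List.ofFn fun i => u i j).prod := by
  have := map_list_prod (Pi.evalMonoidHom (fun _ : Fin k => M) j) (List.ofFn u)
  rw [List.map_ofFn] at this
  exact this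

/-- If some factor receives nothing, it has degree `0`, which is not allowed. -/
theorem tupleBracketingPlace_eq_zero {k m : ℕ} {d : Fin k → ℕ} (hd : ∀ j, 0 < d j)
    {g : Fin m → Fin k} (hg : ¬ Function.Surjective g) :
    (tupleBracketingPlace d g : MultilinearMap F (fun _ : Fin m => FreeAlg F X) _) = 0 := by
  refine multilinear_ext_word fun u => ?_
  simp only [Function.Surjective, not_forall, not_exists] at hg
  obtain ⟨j, hj⟩ := hg
  rw [tupleBracketingPlace_word, tupleBracketing, linExt_single, if_neg]
  · simp
  · intro h
    have h1 := h j
    rw [prod_ofFn_apply, List.prod_eq_one] at h1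
    · have := hd j
      simp at h1
      omega
    · intro x hx
      obtain ⟨i, rfl⟩ := List.mem_ofFn.1 hx
      exact Pi.mulSingle_eq_of_ne (fun h => hj i h.symm) _

variable (F) in
/-- The bracketing operator on the homogeneous component of degree `d`. -/
def bracketingDeg (d : ℕ) : FreeAlg F X →ₗ[F] FreeAlg F X :=
  linExt fun u => if u.length = d then bracketing F u.toList else 0

theorem bracketingDeg_word (d : ℕ) (l : List X) :
    bracketingDeg F d (word F l) = if l.length = d then bracketing F l else 0 := by
  rw [bracketingDeg, linExt_word]
  rfl

theorem bracketingDeg_bracketing (d : ℕ) {l : List X} (hl : l ≠ []) :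
    bracketingDeg F d (bracketing F l) = if l.length = d then (d : F) • bracketing F l else 0 := by
  split_ifs with h
  · subst h
    rw [← bracketingLin_bracketing hl]
    refine LinearMap.eqOn_span (f := bracketingDeg F l.length) (g := bracketingLin F) ?_
      (bracketing_mem_span_length l)
    rintro _ ⟨v, hv, rfl⟩
    rw [bracketingDeg_word, bracketingLin_word]
    exact if_pos hv
  · have : Submodule.span F (word F '' {w | w.length = l.length}) ≤
        LinearMap.ker (bracketingDeg F (X := X) d) := by
      rw [Submodule.span_le]
      rintro _ ⟨v, hv, rfl⟩
      have hv : v.length = l.length := hv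
      simp [bracketingDeg_word, hv, h]
    exact this (bracketing_mem_span_length l)

theorem tupleBracketingPlace_equiv {k : ℕ} (d : Fin k → ℕ) (g : Equiv.Perm (Fin k))
    (x : Fin k → FreeAlg F X) : tupleBracketingPlace d g x
      = (List.ofFn fun j => bracketingDeg F (d j) (x (g.symm j))).prod := by
  have h : (tupleBracketingPlace d g : MultilinearMap F (fun _ : Fin k => FreeAlg F X) _)
      = ((MultilinearMap.mkPiAlgebraFin F k (FreeAlg F X)).compLinearMap
        fun j => bracketingDeg F (d j)).domDomCongr g.symm := by
    refine multilinear_ext_word fun u => ?_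
    have hu : (List.ofFn fun i => (Pi.mulSingle (g i) (FreeMonoid.ofList (u i)) :
        Fin k → FreeMonoid X)).prod = fun j => FreeMonoid.ofList (u (g.symm j)) := by
      funext j
      rw [prod_ofFn_apply, List.ofFn_eq_map, List.prod_map_eq_pow_single (g.symm j),
        List.count_eq_one_of_mem (List.nodup_finRange k) (List.mem_finRange _)]
      · simp
      · intro i hi _
        exact Pi.mulSingle_eq_of_ne (by rintro rfl; simp at hi) _
    rw [tupleBracketingPlace_word, hu, tupleBracketing, linExt_single]
    simp only [MultilinearMap.domDomCongr_apply, MultilinearMap.compLinearMap_apply,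
      MultilinearMap.mkPiAlgebraFin_apply, bracketingDeg_word]
    split_ifs with h
    · simp only [FreeMonoid.toList_ofList]
      congr 2
      funext j
      exact (if_pos (h j)).symm
    · push Not at h
      obtain ⟨j, hj⟩ := h
      symm
      apply List.prod_eq_zero
      rw [List.mem_ofFn]
      exact ⟨j, if_neg hj⟩
  rw [h]
  rfl

/-- The symmetrised product of the elements `x i` of degrees `len i`: the sum of their products in
all orders for which the degrees are `d 0, …, d (k - 1)`. -/
def symProd {k : ℕ} {ι : Type*} [Fintype ι] [DecidableEq ι] (d : Fin k → ℕ) (len : ι → ℕ) :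
    MultilinearMap F (fun _ : ι => FreeAlg F X) (FreeAlg F X) :=
  ∑ f : Fin k ≃ ι with ∀ j, len (f j) = d j,
    (MultilinearMap.mkPiAlgebraFin F k (FreeAlg F X)).domDomCongr f

theorem symProd_apply {k : ℕ} {ι : Type*} [Fintype ι] [DecidableEq ι] (d : Fin k → ℕ)
    (len : ι → ℕ) (x : ι → FreeAlg F X) : symProd d len x =
      ∑ f : Fin k ≃ ι with ∀ j, len (f j) = d j, (List.ofFn fun j => x (f j)).prod := by
  simp [symProd]

theorem symProd_reindex {k : ℕ} {ι ι' : Type*} [Fintype ι] [DecidableEq ι] [Fintype ι']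
    [DecidableEq ι'] (d : Fin k → ℕ) (e : ι ≃ ι') (len : ι' → ℕ) (x : ι' → FreeAlg F X) :
    symProd d (fun i => len (e i)) (fun i => x (e i)) = symProd d len x := by
  rw [symProd_apply, symProd_apply]
  refine Finset.sum_equiv (Equiv.equivCongr (Equiv.refl _) e) (fun f => ?_) fun f _ => ?_
  · simp
  · simp

/-- The convolution operator maps a product of Lie monomials to a multiple of the symmetrised
product: since Lie monomials are primitive, each factor of the coproduct receives exactly one of
them, and there the Dynkin–Specht–Wever theorem applies. -/
theorem convBracketing_prod {k : ℕ} {d : Fin k → ℕ} (hd : ∀ j, 0 < d j) {r : Fin k → List X}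
    (hr : ∀ i, r i ≠ []) : convBracketing F X d (List.ofFn fun i => bracketing F (r i)).prod
      = (∏ j, (d j : F)) • symProd d (fun i => (r i).length) fun i => bracketing F (r i) := by
  classical
  have h1 : convBracketing F X d (List.ofFn fun i => bracketing F (r i)).prod
      = ∑ g : Fin k → Fin k, tupleBracketingPlace d g fun i => bracketing F (r i) := by
    simp only [convBracketing, LinearMap.comp_apply, AlgHom.toLinearMap_apply, map_list_prod,
      List.map_ofFn, tupleBracketingPlace_apply]
    rw [← map_sum, ← prod_ofFn_sum (F := F) fun i j => place j (bracketing F (r i))]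
    congr 3
    funext i
    exact coprod_bracketing k (hr i)
  -- only surjective, hence bijective, distributions of the factors survive
  have h2 : ∑ g : Fin k → Fin k, tupleBracketingPlace d g (fun i => bracketing F (r i))
      = ∑ g : Equiv.Perm (Fin k), tupleBracketingPlace d g.symm fun i => bracketing F (r i) := by
    symm
    refine Finset.sum_of_injOn (fun g : Equiv.Perm (Fin k) => (g.symm : Fin k → Fin k))
      (fun g _ g' _ h => Equiv.symm_bijective.injective (DFunLike.coe_injective h)) (by simp) ?_
      (by simp)
    intro g _ hg
    rw [tupleBracketingPlace_eq_zero hd]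
    · rfl
    · intro hs
      refine hg ⟨(Equiv.ofBijective g (Finite.injective_iff_bijective.1
        (Finite.injective_iff_surjective.2 hs))).symm, by simp, rfl⟩
  rw [h1, h2, symProd_apply, Finset.smul_sum, Finset.sum_filter]
  refine Finset.sum_congr rfl fun g _ => ?_
  rw [tupleBracketingPlace_equiv]
  simp only [Equiv.symm_symm, bracketingDeg_bracketing _ (hr _)]
  split_ifs with h
  · rw [← prod_ofFn_smul]
    congr 2
    funext j
    rw [if_pos (h j)]
  · push Not at h
    obtain ⟨j, hj⟩ := h
    apply List.prod_eq_zero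
    rw [List.mem_ofFn]
    exact ⟨j, if_neg hj⟩

/-- The subword of `w` on the positions `i` with `g i = j`. -/
def subword {n k : ℕ} (w : Fin n → X) (g : Fin n → Fin k) (j : Fin k) : List X :=
  ((List.finRange n).filter fun i => g i = j).map w

theorem convBracketing_word {n k : ℕ} (d : Fin k → ℕ) (w : Fin n → X) :
    convBracketing F X d (word F (List.ofFn w)) = ∑ g : Fin n → Fin k with
      ∀ j, (subword w g j).length = d j,
        (List.ofFn fun j => bracketing F (subword w g j)).prod := by
  have hw : word F (List.ofFn w) = (List.ofFn fun i => word F [w i]).prod := by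
    have : List.ofFn w = (List.ofFn fun i => [w i]).flatten := by
      rw [List.ofFn_eq_map, List.ofFn_eq_map, ← List.flatMap_def, List.map_eq_flatMap]
    rw [this, word_flatten, List.map_ofFn]
    rfl
  have h1 : convBracketing F X d (word F (List.ofFn w))
      = ∑ g : Fin n → Fin k, tupleBracketingPlace d g fun i => word F [w i] := by
    simp only [hw, convBracketing, LinearMap.comp_apply, AlgHom.toLinearMap_apply, map_list_prod,
      List.map_ofFn, tupleBracketingPlace_apply]
    rw [← map_sum, ← prod_ofFn_sum (F := F) fun i j => place j (word F [w i])]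
    congr 3
    funext i
    exact coprod_letter k (w i)
  rw [h1, Finset.sum_filter]
  refine Finset.sum_congr rfl fun g _ => ?_
  have hu : (List.ofFn fun i => (Pi.mulSingle (g i) (FreeMonoid.ofList [w i]) :
        Fin k → FreeMonoid X)).prod = fun j => FreeMonoid.ofList (subword w g j) := by
    funext j
    rw [prod_ofFn_apply, List.ofFn_eq_map, subword]
    induction List.finRange n with
    | nil => rfl
    | cons i L ih =>
      rw [List.map_cons, List.prod_cons, ih]
      by_cases h : g i = j
      · subst h
        simp
      · simp [h]
  rw [tupleBracketingPlace_word, hu, tupleBracketing, linExt_single]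
  rfl

theorem subword_comp_equiv {n k : ℕ} (w : Fin n → X) (g : Fin n → Fin k) (e : Equiv.Perm (Fin k))
    (j : Fin k) : subword w (e ∘ g) j = subword w g (e.symm j) := by
  simp [subword, Equiv.eq_symm_apply]

theorem flatten_subword_perm {n k : ℕ} (w : Fin n → X) (g : Fin n → Fin k) :
    (List.ofFn (subword w g)).flatten.Perm (List.ofFn w) := by
  have h : (List.ofFn fun j => (List.finRange n).filter fun i => g i = j).flatten.Perm
      (List.finRange n) := by
    rw [List.perm_iff_count]
    intro i
    rw [List.count_flatten, List.map_ofFn, List.sum_ofFn, Finset.sum_eq_single (g i)]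
    · simp [List.count_filter]
    · intro j _ hj
      simp [List.count_eq_zero, hj.symm]
    · simp
  have := h.map w
  rw [List.map_flatten, List.map_ofFn] at this
  rwa [List.ofFn_eq_map (f := w)]

/-- A sum over functions to `Fin k` supported on surjections, decomposed into orbits of the free
action of the permutations of `Fin k`. -/
theorem sum_mem_of_orbit_sum_mem {α V : Type*} [Fintype α] [DecidableEq α] [AddCommGroup V] {k : ℕ}
    {W : AddSubgroup V} (φ : (α → Fin k) → V) (h0 : ∀ g, ¬ Function.Surjective g → φ g = 0)
    (h : ∀ g, Function.Surjective g → ∑ e : Equiv.Perm (Fin k), φ (e ∘ g) ∈ W) :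
    ∑ g, φ g ∈ W := by
  classical
  let s : Setoid (α → Fin k) :=
    { r := fun g g' => ∃ e : Equiv.Perm (Fin k), e ∘ g = g'
      iseqv := by
        refine ⟨fun g => ⟨1, rfl⟩, ?_, ?_⟩
        · rintro g _ ⟨e, rfl⟩
          exact ⟨e.symm, by funext; simp⟩
        · rintro g _ _ ⟨e, rfl⟩ ⟨e', rfl⟩
          exact ⟨e' * e, rfl⟩ }
  rw [← Finset.sum_fiberwise Finset.univ (fun g => (Quotient.mk s g)) φ]
  refine W.sum_mem fun o _ => ?_
  by_cases ho : Function.Surjective o.out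
  · have : ∑ g with Quotient.mk s g = o, φ g = ∑ e : Equiv.Perm (Fin k), φ (e ∘ o.out) := by
      symm
      refine Finset.sum_of_injOn (fun e : Equiv.Perm (Fin k) => e ∘ o.out) ?_ ?_ ?_ (by simp)
      · intro e _ e' _ h
        exact DFunLike.coe_injective (ho.injective_comp_right h)
      · intro e _
        simp only [Finset.coe_filter, Finset.mem_univ, true_and, Set.mem_ofPred_eq]
        rw [← o.out_eq]
        exact (Quotient.sound (s := s) ⟨e, by simp⟩ : _).symm
      · intro g hg hg'
        simp only [Finset.mem_filter, Finset.mem_univ, true_and] at hg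
        rw [← o.out_eq] at hg
        obtain ⟨e, he⟩ := Quotient.exact (s := s) hg.symm
        exact absurd ⟨e, by simp, he⟩ hg'
    rw [this]
    exact h _ ho
  · rw [Finset.sum_eq_zero]
    · exact W.zero_mem
    · intro g hg
      simp only [Finset.mem_filter, Finset.mem_univ, true_and] at hg
      rw [← o.out_eq] at hg
      obtain ⟨e, he⟩ := Quotient.exact (s := s) hg
      refine h0 g fun hs => ho ?_
      rw [← he]
      exact e.surjective.comp hs

/-- The value of the convolution operator at a word is a sum of symmetrised products. -/
theorem convBracketing_word_mem {n k : ℕ} {d : Fin k → ℕ} (hd : ∀ j, 0 < d j) (w : Fin n → X) :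
    convBracketing F X d (word F (List.ofFn w)) ∈ Submodule.span F
      ((fun r : Fin k → List X => symProd d (fun i => (r i).length) fun i => bracketing F (r i)) ''
        {r | (∀ j, r j ≠ []) ∧ (List.ofFn r).flatten.Perm (List.ofFn w)}) := by
  rw [convBracketing_word, Finset.sum_filter]
  refine sum_mem_of_orbit_sum_mem (W := (Submodule.span F _).toAddSubgroup) _ ?_ ?_
  · intro g hg
    simp only [Function.Surjective, not_forall, not_exists] at hg
    obtain ⟨j, hj⟩ := hg
    rw [if_neg]
    intro h
    have h1 := h j
    have h2 := hd j
    have h3 : subword w g j = [] := by simp [subword, hj]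
    rw [h3] at h1
    simp at h1
    omega
  · intro g hg
    refine Submodule.subset_span ⟨subword w g, ⟨fun j h => ?_, flatten_subword_perm w g⟩, ?_⟩
    · obtain ⟨i, rfl⟩ := hg j
      simp only [subword, List.map_eq_nil_iff, List.filter_eq_nil_iff] at h
      simpa using h i
    · simp only [symProd_apply, Finset.sum_filter]
      refine Fintype.sum_equiv (Equiv.inv _) _ _ fun e => ?_
      have : ∀ j, subword w (⇑e.symm ∘ g) j = subword w g (e j) := fun j => by
        rw [subword_comp_equiv]
        rfl
      simp [this]

end Convolution

/-! ### The Pólya action of the elements `ω_m` and `ω_q` -/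

section PolyaAction

variable {F : Type*} [Field F] {X : Type*}

/-- The Pólya action on the word `w`, extended linearly to the group algebra. -/
def polya {m : ℕ} (w : Fin m → X) : GroupAlg F m →ₗ[F] FreeAlg F X :=
  linExt fun τ => word F (List.ofFn fun i => w (app τ i))

theorem polya_single {m : ℕ} (w : Fin m → X) (τ : Sym m) :
    polya w (MonoidAlgebra.single τ 1 : GroupAlg F m) = word F (List.ofFn fun i => w (app τ i)) :=
  linExt_single _ _

theorem polya_mul_single {m : ℕ} (w : Fin m → X) (x : GroupAlg F m) (σ : Sym m) :
    polya w (x * MonoidAlgebra.single σ 1) = polya (fun i => w (app σ i)) x := by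
  have h : polya w ∘ₗ LinearMap.mulRight F (MonoidAlgebra.single σ 1 : GroupAlg F m)
      = polya fun i => w (app σ i) := by
    refine linearMap_ext_single fun τ => ?_
    simp [polya_single, MonoidAlgebra.single_mul_single, app_mul]
  exact LinearMap.congr_fun h x

theorem polya_one {m : ℕ} (w : Fin m → X) :
    polya w (1 : GroupAlg F m) = word F (List.ofFn w) :=
  polya_single w 1

/-- The embedding of `F S_m` into `F S_{m+1}` fixing the last letter. -/
def extendLast (F : Type*) [Field F] (m : ℕ) : GroupAlg F m →ₐ[F] GroupAlg F (m + 1) :=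
  MonoidAlgebra.mapDomainAlgHom F F
    (MonoidHom.op (Equiv.Perm.viaEmbeddingHom (Fin.castSuccEmb (n := m))))

theorem extendLast_single {m : ℕ} (τ : Sym m) :
    extendLast F m (MonoidAlgebra.single τ 1) = MonoidAlgebra.single
      (MulOpposite.op (τ.unop.viaEmbedding (Fin.castSuccEmb (n := m)))) 1 := by
  simp [extendLast, Equiv.Perm.viaEmbeddingHom_apply]

theorem viaEmbedding_castSucc {m : ℕ} (τ : Equiv.Perm (Fin m)) (i : Fin m) :
    τ.viaEmbedding (Fin.castSuccEmb (n := m)) i.castSucc = (τ i).castSucc :=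
  τ.viaEmbedding_apply (Fin.castSuccEmb (n := m)) i

theorem viaEmbedding_last {m : ℕ} (τ : Equiv.Perm (Fin m)) :
    τ.viaEmbedding (Fin.castSuccEmb (n := m)) (Fin.last m) = Fin.last m :=
  τ.viaEmbedding_apply_of_notMem _ _ (by
    rintro ⟨i, hi⟩
    exact (Fin.castSucc_lt_last i).ne hi)

theorem descCycle_castSucc {m : ℕ} (k : Fin m) :
    extendLast F m (MonoidAlgebra.single (descCycle k) 1)
      = MonoidAlgebra.single (descCycle k.castSucc) 1 := by
  rw [extendLast_single, descCycle, descCycle]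
  congr 2
  have h : (Fin.cycleRange k).viaEmbedding (Fin.castSuccEmb (n := m))
      = Fin.cycleRange k.castSucc := by
    ext i
    cases i using Fin.lastCases with
    | last => rw [viaEmbedding_last, Fin.cycleRange_of_gt (Fin.castSucc_lt_last k)]
    | cast i =>
      rw [viaEmbedding_castSucc]
      rcases le_or_gt i k with hik | hik
      · rw [Fin.val_castSucc, Fin.coe_cycleRange_of_le hik,
          Fin.coe_cycleRange_of_le (Fin.castSucc_le_castSucc_iff.2 hik)]
        simp
      · rw [Fin.cycleRange_of_gt hik, Fin.cycleRange_of_gt (Fin.castSucc_lt_castSucc_iff.2 hik)]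
  rw [← h]
  exact map_inv (Equiv.Perm.viaEmbeddingHom (Fin.castSuccEmb (n := m))) _

theorem wever_succ {m : ℕ} (hm : 0 < m) : wever F (m + 1) =
    (1 - MonoidAlgebra.single (descCycle (Fin.last m)) 1) * extendLast F m (wever F m) := by
  rw [wever, wever, List.finRange_succ_last, List.filter_append, List.filter_singleton,
    List.filter_map, map_list_prod]
  simp only [Fin.val_last, hm, decide_true, cond_true, List.reverse_append, List.reverse_singleton,
    List.singleton_append, List.map_cons, List.prod_cons, List.map_reverse, List.map_map]
  congr 4
  funext k
  simp only [Function.comp_apply, map_sub, map_one, descCycle_castSucc]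

theorem polya_extendLast {m : ℕ} (w : Fin (m + 1) → X) (x : GroupAlg F m) :
    polya w (extendLast F m x) = polya (fun i => w i.castSucc) x * word F [w (Fin.last m)] := by
  have h : polya w ∘ₗ (extendLast F m).toLinearMap
      = LinearMap.mulRight F (word F [w (Fin.last m)]) ∘ₗ polya fun i => w i.castSucc := by
    refine linearMap_ext_single fun τ => ?_
    simp only [LinearMap.comp_apply, AlgHom.toLinearMap_apply, extendLast_single, polya_single,
      LinearMap.mulRight_apply, ← word_append]
    rw [List.ofFn_succ', List.concat_eq_append]
    simp only [app, MulOpposite.unop_op, viaEmbedding_castSucc, viaEmbedding_last]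
  exact LinearMap.congr_fun h x

theorem polya_descCycle_mul_extendLast {m : ℕ} (w : Fin (m + 1) → X) (x : GroupAlg F m) :
    polya w (MonoidAlgebra.single (descCycle (Fin.last m)) 1 * extendLast F m x)
      = word F [w (Fin.last m)] * polya (fun i => w i.castSucc) x := by
  have h : polya w ∘ₗ LinearMap.mulLeft F (MonoidAlgebra.single (descCycle (Fin.last m)) 1) ∘ₗ
      (extendLast F m).toLinearMap
      = LinearMap.mulLeft F (word F [w (Fin.last m)]) ∘ₗ polya fun i => w i.castSucc := by
    refine linearMap_ext_single fun τ => ?_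
    simp only [LinearMap.comp_apply, AlgHom.toLinearMap_apply, extendLast_single, polya_single,
      LinearMap.mulLeft_apply, ← word_append, MonoidAlgebra.single_mul_single, mul_one]
    have h0 : (Fin.cycleRange (Fin.last m))⁻¹ 0 = Fin.last m :=
      Fin.cycleRange_symm_zero (Fin.last m)
    have h1 : ∀ j : Fin m, (Fin.cycleRange (Fin.last m))⁻¹ j.succ = j.castSucc := fun j =>
      (Fin.cycleRange_symm_succ (Fin.last m) j).trans (Fin.succAbove_last_apply j)
    rw [List.ofFn_succ]
    simp only [app_mul]
    simp only [app, descCycle, MulOpposite.unop_op, h0, h1, viaEmbedding_castSucc,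
      viaEmbedding_last, List.singleton_append]
  exact LinearMap.congr_fun h x

/-- `ω_m` acts on words as the left-normed bracketing. -/
theorem polya_wever {m : ℕ} (w : Fin m → X) : polya w (wever F m) = bracketing F (List.ofFn w) := by
  induction m with
  | zero =>
    have : wever F 0 = 1 := by simp [wever]
    rw [this, polya_one]
    simp
  | succ m ih =>
    rcases Nat.eq_zero_or_pos m with rfl | hm
    · have : wever F 1 = 1 := by simp [wever, List.finRange_succ]
      rw [this, polya_one]
      simp
    · rw [wever_succ hm, sub_mul, one_mul, map_sub, polya_extendLast,
        polya_descCycle_mul_extendLast, ih, List.ofFn_succ', List.concat_eq_append,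
        bracketing_concat]
      intro h
      have := congrArg List.length h
      simp at this
      omega

theorem lieWord_eq {m n : ℕ} (w : Fin m → Fin n) :
    lieWord F w = bracketing F (List.ofFn w) := by
  rw [← polya_wever]
  have h : MonoidAlgebra.mapDomainLinearMap F F (fun τ : Sym m => wordOf fun i => w (app τ i))
      = polya (F := F) w := by
    refine linearMap_ext_single fun τ => ?_
    rw [MonoidAlgebra.mapDomainLinearMap_single, polya_single]
    rfl
  exact LinearMap.congr_fun h _

theorem ofFn_eq_flatten {n : ℕ} (q : Composition n) (w : Fin n → X) :
    List.ofFn w = (List.ofFn fun j => List.ofFn fun i => w (q.embedding j i)).flatten := by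
  have hlen : ∀ (l : List X) (q : Composition n), l.length = n →
      (l.splitWrtComposition q).flatten = l := by
    intro l q hl
    subst hl
    exact List.flatten_splitWrtComposition l q
  rw [← hlen (List.ofFn w) q (by simp)]
  congr 1
  apply List.ext_getElem
  · simp
  · intro j h1 h2
    rw [List.getElem_splitWrtComposition', List.getElem_ofFn]
    have hj : j < q.length := by simpa using h2
    have h3 := q.sizeUpTo_succ hj
    have h4 := q.sizeUpTo_le (j + 1)
    apply List.ext_getElem
    · simp only [List.length_drop, List.length_take, List.length_ofFn]
      rw [min_eq_left h4, h3, Nat.add_sub_cancel_left]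
      rfl
    · intro i h5 h6
      simp only [List.getElem_drop, List.getElem_take, List.getElem_ofFn]
      rfl

theorem app_prod_blockShift {n : ℕ} (q : Composition n) (τ : ∀ j, Sym (q.blocksFun j))
    (L : List (Fin q.length)) (hL : L.Nodup) (j : Fin q.length) (i : Fin (q.blocksFun j)) :
    app (L.map fun j => MonoidHom.op (Equiv.Perm.viaEmbeddingHom (q.embedding j).toEmbedding)
      (τ j)).prod (q.embedding j i) = if j ∈ L then q.embedding j (app (τ j) i)
        else q.embedding j i := by
  have h1 : ∀ j i, app (MonoidHom.op (Equiv.Perm.viaEmbeddingHom (q.embedding j).toEmbedding)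
      (τ j)) (q.embedding j i) = q.embedding j (app (τ j) i) := fun j i =>
    Equiv.Perm.viaEmbedding_apply (τ j).unop (q.embedding j).toEmbedding i
  have h2 : ∀ j j' i, j ≠ j' → app (MonoidHom.op (Equiv.Perm.viaEmbeddingHom
      (q.embedding j').toEmbedding) (τ j')) (q.embedding j i) = q.embedding j i := by
    intro j j' i hj
    refine Equiv.Perm.viaEmbedding_apply_of_notMem (τ j').unop (q.embedding j').toEmbedding _ ?_
    rintro ⟨i', hi'⟩
    exact Set.disjoint_left.1 (q.disjoint_range hj) ⟨i, rfl⟩ ⟨i', hi'⟩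
  induction L generalizing i with
  | nil => rfl
  | cons a L ih =>
    have ha := List.nodup_cons.1 hL
    rw [List.map_cons, List.prod_cons, app_mul]
    by_cases hja : j = a
    · subst hja
      rw [h1, ih ha.2, if_neg ha.1, if_pos (by simp)]
    · rw [h2 _ _ _ hja, ih ha.2]
      simp [hja]

theorem polya_blockShift_prod {n : ℕ} (q : Composition n) (w : Fin n → X)
    (x : ∀ j, GroupAlg F (q.blocksFun j)) :
    polya w (List.ofFn fun j => blockShift F q j (x j)).prod
      = (List.ofFn fun j => polya (fun i => w (q.embedding j i)) (x j)).prod := by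
  have h : (polya w).compMultilinearMap
      ((MultilinearMap.mkPiAlgebraFin F q.length (GroupAlg F n)).compLinearMap
        fun j => (blockShift F q j).toLinearMap)
      = (MultilinearMap.mkPiAlgebraFin F q.length (FreeAlg F X)).compLinearMap
        fun j => polya (fun i => w (q.embedding j i)) := by
    refine Module.Basis.ext_multilinear
      (fun j => MonoidAlgebra.basis (Sym (q.blocksFun j)) F) fun τ => ?_
    simp only [MonoidAlgebra.basis_apply, LinearMap.compMultilinearMap_apply,
      MultilinearMap.compLinearMap_apply, MultilinearMap.mkPiAlgebraFin_apply, polya_single,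
      AlgHom.toLinearMap_apply]
    have h1 : (List.ofFn fun j => blockShift F q j (MonoidAlgebra.single (τ j) 1)).prod
        = MonoidAlgebra.single (List.ofFn fun j => MonoidHom.op (Equiv.Perm.viaEmbeddingHom
          (q.embedding j).toEmbedding) (τ j)).prod 1 := by
      rw [← prod_ofFn_single]
      simp only [blockShift, MonoidAlgebra.mapDomainAlgHom_apply, MonoidAlgebra.mapDomain_single]
    rw [h1, polya_single, ofFn_eq_flatten q, word_flatten, List.map_ofFn]
    congr 2
    funext j
    simp only [Function.comp_apply]
    congr 2
    funext i
    rw [List.ofFn_eq_map (n := q.length), app_prod_blockShift q τ _ (List.nodup_finRange _),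
      if_pos (List.mem_finRange _)]
  exact MultilinearMap.congr_fun h x

theorem polya_weverYoung {n : ℕ} (q : Composition n) (w : Fin n → X) :
    polya w (weverYoung F q)
      = (List.ofFn fun j => bracketing F (List.ofFn fun i => w (q.embedding j i))).prod := by
  rw [weverYoung, polya_blockShift_prod]
  simp only [polya_wever]

end PolyaAction

/-! ### The action of `ω_q` as a convolution product -/

section PolyaHigher

variable {F : Type*} [Field F] {X : Type*}

/-- The permutations occurring in `Ξ^q` are those that increase on each block of `q`. -/
theorem des_subset_iff {n : ℕ} (q : Composition n) (σ : Sym n) :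
    Des σ ⊆ {i | ∃ j, 1 ≤ j ∧ j ≤ q.length ∧ i = q.sizeUpTo j} ↔
      ∀ j, StrictMono fun i => app σ (q.embedding j i) := by
  constructor
  · intro h j
    -- a position inside a block is not a partial sum
    have key : ∀ a (h1 : a + 1 < q.blocksFun j),
        app σ (q.embedding j ⟨a, by omega⟩) < app σ (q.embedding j ⟨a + 1, h1⟩) := by
      intro a h1
      by_contra hcon
      have hlt : app σ (q.embedding j ⟨a + 1, h1⟩) < app σ (q.embedding j ⟨a, by omega⟩) := by
        refine lt_of_le_of_ne (not_lt.1 hcon) fun h2 => ?_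
        have h3 := (q.embedding j).injective (σ.unop.injective h2)
        simp at h3
      have hn : q.sizeUpTo j + (a + 1) < n := (q.embedding j ⟨a + 1, h1⟩).isLt
      obtain ⟨j', hj1, hj2, hj3⟩ := h (show q.sizeUpTo j + (a + 1) ∈ Des σ from
        ⟨by omega, hn, hlt⟩)
      have hs := q.sizeUpTo_succ' j
      rcases le_or_gt j' j with hle | hgt
      · have := q.monotone_sizeUpTo hle
        omega
      · have := q.monotone_sizeUpTo (show (j : ℕ) + 1 ≤ j' from hgt)
        omega
    have key2 : ∀ d a (h1 : a + (d + 1) < q.blocksFun j),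
        app σ (q.embedding j ⟨a, by omega⟩) < app σ (q.embedding j ⟨a + (d + 1), h1⟩) := by
      intro d
      induction d with
      | zero => exact fun a h1 => key a h1
      | succ d ih => exact fun a h1 => (ih a (by omega)).trans (key (a + (d + 1)) h1)
    rintro ⟨a, ha⟩ ⟨b, hb⟩ hab
    obtain ⟨d, rfl⟩ := Nat.exists_eq_add_of_lt (Fin.mk_lt_mk.1 hab)
    exact key2 d a hb
  · rintro h i ⟨h0, hn, hlt⟩
    by_contra hcon
    let x : Fin n := ⟨i, hn⟩
    have h1 := q.sizeUpTo_index_le x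
    have h2 := q.lt_sizeUpTo_index_succ x
    have hne : q.sizeUpTo (q.index x) ≠ i := by
      intro heq
      refine hcon ⟨q.index x, ?_, (q.index x).isLt.le, heq.symm⟩
      by_contra h3
      have h4 : (q.index x : ℕ) = 0 := by omega
      rw [h4, q.sizeUpTo_zero] at heq
      omega
    have hs := q.sizeUpTo_succ' (q.index x)
    have h1' : q.sizeUpTo (q.index x) ≤ i := h1
    have h2' : i < q.sizeUpTo ((q.index x : ℕ) + 1) := h2
    have hmono := h (q.index x) (show (⟨i - 1 - q.sizeUpTo (q.index x), by omega⟩ :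
      Fin (q.blocksFun (q.index x))) < ⟨i - q.sizeUpTo (q.index x), by omega⟩ from
        Fin.mk_lt_mk.2 (by omega))
    have e1 : q.embedding (q.index x) ⟨i - 1 - q.sizeUpTo (q.index x), by omega⟩
        = ⟨i - 1, by omega⟩ := Fin.ext (by simp; omega)
    have e2 : q.embedding (q.index x) ⟨i - q.sizeUpTo (q.index x), by omega⟩ = ⟨i, hn⟩ :=
      Fin.ext (by simp; omega)
    simp only [e1, e2] at hmono
    exact absurd hmono hlt.asymm

/-- The block of `q` containing the position of the letter `x` in `σ`. -/
def blockOf {n : ℕ} (q : Composition n) (σ : Sym n) (x : Fin n) : Fin q.length :=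
  q.index (σ.unop.symm x)

/-- If `σ` increases on each block, the letters in a block, read in increasing order, are read in
the order of their positions. -/
theorem subword_blockOf {n : ℕ} (q : Composition n) {σ : Sym n}
    (hσ : ∀ j, StrictMono fun i => app σ (q.embedding j i)) (w : Fin n → X) (j : Fin q.length) :
    subword w (blockOf q σ) j = List.ofFn fun i => w (app σ (q.embedding j i)) := by
  have h : (List.finRange n).filter (fun x => blockOf q σ x = j)
      = List.ofFn fun i => app σ (q.embedding j i) := by
    refine List.Perm.eq_of_pairwise (le := (· < ·)) (fun a b _ _ h1 h2 => absurd h1 h2.asymm)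
      ?_ ?_ ?_
    · exact (List.pairwise_lt_finRange n).filter _
    · exact List.pairwise_ofFn.2 fun a b hab => hσ j hab
    · rw [List.perm_ext_iff_of_nodup ((List.nodup_finRange n).filter _)
        (List.nodup_ofFn.2 (hσ j).injective)]
      intro x
      simp only [List.mem_filter, List.mem_finRange, true_and, decide_eq_true_eq, List.mem_ofFn]
      change q.index (σ.unop.symm x) = j ↔ _
      constructor
      · rintro rfl
        exact ⟨q.invEmbedding (σ.unop.symm x), by
          rw [q.embedding_comp_inv]
          exact σ.unop.apply_symm_apply x⟩
      · rintro ⟨i, rfl⟩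
        simp [app, q.index_embedding]
  rw [subword, h, List.map_ofFn]
  rfl

theorem eq_of_blockOf_eq {n : ℕ} (q : Composition n) {σ τ : Sym n}
    (hσ : ∀ j, StrictMono fun i => app σ (q.embedding j i))
    (hτ : ∀ j, StrictMono fun i => app τ (q.embedding j i)) (h : blockOf q σ = blockOf q τ) :
    σ = τ := by
  have key : ∀ j i, app σ (q.embedding j i) = app τ (q.embedding j i) := by
    intro j
    have h1 := subword_blockOf q hσ id j
    rw [h, subword_blockOf q hτ id j] at h1
    exact fun i => (congrFun (List.ofFn_injective h1) i).symm
  apply MulOpposite.unop_injective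
  ext x
  have := key (q.index x) (q.invEmbedding x)
  rw [q.embedding_comp_inv] at this
  exact congrArg Fin.val this

/-- Every distribution of the letters over blocks of the right sizes is realised by a permutation
increasing on each block: it enumerates the letters of each block in increasing order. -/
theorem exists_blockOf_eq {n : ℕ} (q : Composition n) {g : Fin n → Fin q.length}
    (hg : ∀ j, (subword id g j).length = q.blocksFun j) :
    ∃ σ : Sym n, (∀ j, StrictMono fun i => app σ (q.embedding j i)) ∧ blockOf q σ = g := by
  have hcard : ∀ j, (Finset.univ.filter fun x => g x = j).card = q.blocksFun j := by
    intro j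
    rw [← hg j, subword, List.map_id, ← List.toFinset_card_of_nodup
      ((List.nodup_finRange n).filter _)]
    congr 1
    ext x
    simp
  let e : ∀ j, Fin (q.blocksFun j) → Fin n := fun j i =>
    (Finset.univ.filter fun x => g x = j).orderEmbOfFin (hcard j) i
  have he : ∀ j i, g (e j i) = j := fun j i => by
    have := Finset.orderEmbOfFin_mem (Finset.univ.filter fun x => g x = j) (hcard j) i
    exact (Finset.mem_filter.1 this).2
  let φ : Fin n → Fin n := fun x => e (q.index x) (q.invEmbedding x)
  have hφ : ∀ j i, φ (q.embedding j i) = e j i := by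
    intro j i
    have : ∀ y : Σ j, Fin (q.blocksFun j), φ (q.blocksFinEquiv y) = e y.1 y.2 := by
      intro y
      obtain ⟨x, rfl⟩ := q.blocksFinEquiv.symm.surjective y
      rw [Equiv.apply_symm_apply]
      rfl
    exact this ⟨j, i⟩
  have hinj : Function.Injective φ := by
    intro x y hxy
    obtain ⟨⟨j, i⟩, rfl⟩ := q.blocksFinEquiv.surjective x
    obtain ⟨⟨j', i'⟩, rfl⟩ := q.blocksFinEquiv.surjective y
    have hxy : φ (q.embedding j i) = φ (q.embedding j' i') := hxy
    rw [hφ, hφ] at hxy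
    obtain rfl : j = j' := by rw [← he j i, hxy, he]
    have := (Finset.orderEmbOfFin _ (hcard j)).injective hxy
    rw [this]
  refine ⟨MulOpposite.op (Equiv.ofBijective φ (Finite.injective_iff_bijective.1 hinj)),
    fun j i i' hii => ?_, ?_⟩
  · change φ (q.embedding j i) < φ (q.embedding j i')
    rw [hφ, hφ]
    exact (Finset.orderEmbOfFin _ (hcard j)).strictMono hii
  · funext x
    obtain ⟨y, rfl⟩ := (Finite.injective_iff_bijective.1 hinj).surjective x
    have : (Equiv.ofBijective φ (Finite.injective_iff_bijective.1 hinj)).symm (φ y) = y :=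
      Equiv.ofBijective_symm_apply_apply φ _ y
    rw [blockOf, MulOpposite.unop_op, this]
    exact (he _ _).symm

/-- `ω_q` acts on words as the convolution product of the bracketing operators of degrees
`q_1, …, q_k`. -/
theorem polya_higherWever {n : ℕ} (q : Composition n) (w : Fin n → X) :
    polya w (higherWever F q) = convBracketing F X q.blocksFun (word F (List.ofFn w)) := by
  classical
  rw [higherWever, descentElt, Finset.mul_sum, map_sum, convBracketing_word]
  refine Finset.sum_bij (fun σ _ => blockOf q σ) ?_ ?_ ?_ ?_
  · intro σ hσ
    simp only [Finset.mem_filter, Finset.mem_univ, true_and, des_subset_iff] at hσ ⊢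
    intro j
    rw [subword_blockOf q hσ, List.length_ofFn]
  · intro σ hσ τ hτ h
    simp only [Finset.mem_filter, Finset.mem_univ, true_and, des_subset_iff] at hσ hτ
    exact eq_of_blockOf_eq q hσ hτ h
  · intro g hg
    simp only [Finset.mem_filter, Finset.mem_univ, true_and] at hg
    obtain ⟨σ, hσ, rfl⟩ := exists_blockOf_eq q (g := g) (by simpa [subword] using hg)
    exact ⟨σ, by simpa [des_subset_iff] using hσ, rfl⟩
  · intro σ hσ
    simp only [Finset.mem_filter, Finset.mem_univ, true_and, des_subset_iff] at hσ
    rw [polya_mul_single, polya_weverYoung]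
    simp only [subword_blockOf q hσ]

/-- A permutation, regarded as a word in the letters `1, …, n`. -/
def toWords (F : Type*) [Field F] (n : ℕ) : GroupAlg F n →ₗ[F] FreeAlg F (Fin n) := polya id

theorem toWords_single {n : ℕ} (σ : Sym n) :
    toWords F n (MonoidAlgebra.single σ 1) = word F (List.ofFn (app σ)) :=
  polya_single _ _

theorem toWords_higherWever_mul {n : ℕ} (q : Composition n) (x : GroupAlg F n) :
    toWords F n (higherWever F q * x) = convBracketing F _ q.blocksFun (toWords F n x) := by
  have h : toWords F n ∘ₗ LinearMap.mulLeft F (higherWever F q)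
      = convBracketing F _ q.blocksFun ∘ₗ toWords F n := by
    refine linearMap_ext_single fun σ => ?_
    rw [LinearMap.comp_apply, LinearMap.comp_apply, toWords_single,
      LinearMap.mulLeft_apply, toWords,
      polya_mul_single, ← polya_higherWever]
    rfl
  exact LinearMap.congr_fun h x

/-- The coefficient extraction `toGroupAlg`, as a linear map. -/
def toGroupAlgLin (F : Type*) [Field F] (n : ℕ) : WordAlg F n →ₗ[F] GroupAlg F n where
  toFun := toGroupAlg
  map_add' x y := by ext σ; simp [toGroupAlg]
  map_smul' c x := by ext σ; simp [toGroupAlg]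

theorem toGroupAlgLin_word {n : ℕ} (σ : Sym n) :
    toGroupAlgLin F n (word F (List.ofFn (app σ))) = MonoidAlgebra.single σ 1 := by
  classical
  apply MonoidAlgebra.ext
  ext τ
  have h : (word F (List.ofFn (app σ))).coeff (FreeMonoid.ofList (List.ofFn (app τ)))
      = if σ = τ then 1 else 0 := by
    rw [← wordCoeff_apply, wordCoeff_word]
    congr 1
    rw [List.ofFn_injective.eq_iff, eq_iff_iff]
    constructor
    · intro h
      exact MulOpposite.unop_injective (DFunLike.coe_injective h)
    · rintro rfl
      rfl
  rw [MonoidAlgebra.coeff_single, Finsupp.single_apply, ← h]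
  rfl

theorem toGroupAlgLin_toWords {n : ℕ} (x : GroupAlg F n) :
    toGroupAlgLin F n (toWords F n x) = x := by
  have h : toGroupAlgLin F n ∘ₗ toWords F n = LinearMap.id := by
    refine linearMap_ext_single fun σ => ?_
    rw [LinearMap.comp_apply, toWords_single, toGroupAlgLin_word]
    rfl
  exact LinearMap.congr_fun h x

theorem toWords_injective (n : ℕ) : Function.Injective (toWords F n) :=
  Function.LeftInverse.injective toGroupAlgLin_toWords

theorem exists_app_eq {n : ℕ} {l : List (Fin n)} (hl : l.Perm (List.finRange n)) :
    ∃ σ : Sym n, l = List.ofFn (app σ) := by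
  have hlen : l.length = n := by simpa using hl.length_eq
  obtain ⟨f, rfl⟩ : ∃ f : Fin n → Fin n, l = List.ofFn f :=
    ⟨fun i => l.get (i.cast hlen.symm), by
      apply List.ext_getElem <;> simp [hlen]⟩
  have hf : Function.Injective f :=
    List.nodup_ofFn.1 (hl.nodup_iff.2 (List.nodup_finRange n))
  exact ⟨MulOpposite.op (Equiv.ofBijective f (Finite.injective_iff_bijective.1 hf)), rfl⟩

/-- On combinations of permutation words, `toGroupAlg` loses nothing. -/
theorem toWords_toGroupAlg {n : ℕ} {x : FreeAlg F (Fin n)}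
    (hx : x ∈ Submodule.span F (word F '' {l | l.Perm (List.finRange n)})) :
    toWords F n (toGroupAlg x) = x := by
  have : Set.EqOn (toWords F n ∘ₗ toGroupAlgLin F n)
      (LinearMap.id : FreeAlg F (Fin n) →ₗ[F] FreeAlg F (Fin n))
      (word F '' {l | l.Perm (List.finRange n)}) := by
    rintro _ ⟨l, hl, rfl⟩
    obtain ⟨σ, rfl⟩ := exists_app_eq hl
    rw [LinearMap.comp_apply, toGroupAlgLin_word, toWords_single]
    rfl
  exact LinearMap.eqOn_span this hx

end PolyaHigher

/-! ### The index set `Γ(λ)` -/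

section Tableaux

variable {n : ℕ} {q : Composition n}

/-- The index set of the sequences `T_{i,j}` of an element `T` of `Γ(λ(q))`. -/
abbrev Row (q : Composition n) : Type := Σ i : ℕ, Fin (mult (partitionOf q) i)

theorem card_blocksFun_eq (q : Composition n) (i : ℕ) :
    Fintype.card {j // q.blocksFun j = i} = mult (partitionOf q) i := by
  have h : (partitionOf q).parts = Finset.univ.val.map q.blocksFun := by
    rw [Fin.univ_val_map, q.ofFn_blocksFun]
    rfl
  rw [mult, h, Multiset.count_map, Fintype.card_subtype, Finset.card_def, Finset.filter_val]
  simp only [eq_comm]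

/-- The rows of a tableau correspond to the parts of `q`, in such a way that lengths match. -/
def rowEquiv (q : Composition n) : Fin q.length ≃ Row q :=
  (Equiv.sigmaFiberEquiv q.blocksFun).symm.trans
    (Equiv.sigmaCongrRight fun i => Fintype.equivFinOfCardEq (card_blocksFun_eq q i))

@[simp]
theorem rowEquiv_fst (q : Composition n) (j : Fin q.length) :
    (rowEquiv q j).1 = q.blocksFun j := rfl

instance instFintypeRow (q : Composition n) : Fintype (Row q) := Fintype.ofEquiv _ (rowEquiv q)

theorem Row.pos (a : Row q) : 0 < a.1 := by
  obtain ⟨j, rfl⟩ := (rowEquiv q).surjective a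
  exact q.one_le_blocksFun j

theorem sum_row_length (q : Composition n) : ∑ a : Row q, a.1 = n := by
  rw [← (rowEquiv q).sum_comp]
  exact q.sum_blocksFun

theorem row_fst_mem (a : Row q) : a.1 ∈ Finset.Icc 1 n :=
  Finset.mem_Icc.2 ⟨a.pos, (Finset.single_le_sum (f := fun a : Row q => a.1)
    (fun _ _ => Nat.zero_le _) (Finset.mem_univ a)).trans_eq (sum_row_length q)⟩

/-- The rows of a tableau in the order in which they appear in the product `Q_T`. -/
def rowList (q : Composition n) : List (Row q) :=
  (List.range' 1 n).reverse.flatMap fun i =>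
    (List.finRange (mult (partitionOf q) i)).map fun j => ⟨i, j⟩

theorem nodup_rowList (q : Composition n) : (rowList q).Nodup := by
  rw [rowList, List.nodup_flatMap]
  refine ⟨fun i _ => (List.nodup_finRange _).map fun j j' h => by simpa using h, ?_⟩
  refine (List.nodup_reverse.2 List.nodup_range').imp fun {i i'} hii => ?_
  intro a ha ha'
  obtain ⟨j, -, rfl⟩ := List.mem_map.1 ha
  obtain ⟨j', -, h⟩ := List.mem_map.1 ha'
  exact hii (congrArg Sigma.fst h).symm

theorem mem_rowList (a : Row q) : a ∈ rowList q := by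
  have h := Finset.mem_Icc.1 (row_fst_mem a)
  rw [rowList, List.mem_flatMap]
  exact ⟨a.1, by simp; omega, List.mem_map.2 ⟨a.2, List.mem_finRange _, rfl⟩⟩

/-- A family of words of the prescribed lengths which together contain all the letters. -/
structure IsFilling (ρ : Row q → List (Fin n)) : Prop where
  length_eq : ∀ a, (ρ a).length = a.1
  cover : ∀ x, ∃ a, x ∈ ρ a

theorem card_cells (q : Composition n) : Fintype.card (Σ a : Row q, Fin a.1) = n := by
  rw [Fintype.card_sigma]
  simpa using sum_row_length q

theorem IsFilling.bijective {ρ : Row q → List (Fin n)} (h : IsFilling ρ) :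
    Function.Bijective fun x : Σ a : Row q, Fin a.1 =>
      (ρ x.1).get (x.2.cast (h.length_eq x.1).symm) := by
  rw [Fintype.bijective_iff_surjective_and_card, card_cells, Fintype.card_fin]
  refine ⟨fun x => ?_, rfl⟩
  obtain ⟨a, ha⟩ := h.cover x
  obtain ⟨i, hi⟩ := List.get_of_mem ha
  exact ⟨⟨a, i.cast (h.length_eq a)⟩, hi⟩

theorem IsFilling.eq_of_mem {ρ : Row q → List (Fin n)} (h : IsFilling ρ) {a b : Row q} {x : Fin n}
    (ha : x ∈ ρ a) (hb : x ∈ ρ b) : a = b := by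
  obtain ⟨i, hi⟩ := List.get_of_mem ha
  obtain ⟨j, hj⟩ := List.get_of_mem hb
  have := h.bijective.injective (a₁ := ⟨a, i.cast (h.length_eq a)⟩)
    (a₂ := ⟨b, j.cast (h.length_eq b)⟩) (hi.trans hj.symm)
  exact congrArg Sigma.fst this

theorem IsFilling.nodup {ρ : Row q → List (Fin n)} (h : IsFilling ρ) (a : Row q) : (ρ a).Nodup := by
  rw [List.nodup_iff_injective_get]
  intro i j hij
  have := h.bijective.injective (a₁ := ⟨a, i.cast (h.length_eq a)⟩)
    (a₂ := ⟨a, j.cast (h.length_eq a)⟩) hij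
  simpa using this

theorem IsFilling.flatten_perm {ρ : Row q → List (Fin n)} (h : IsFilling ρ) :
    ((rowList q).map ρ).flatten.Perm (List.finRange n) := by
  refine (List.Subperm.perm_of_length_le
    (List.subperm_of_subset (List.nodup_finRange n) ?_) ?_).symm
  · intro x _
    obtain ⟨a, ha⟩ := h.cover x
    exact List.mem_flatten.2 ⟨ρ a, List.mem_map.2 ⟨a, mem_rowList a, rfl⟩, ha⟩
  · rw [List.length_flatten, List.map_map, List.length_finRange]
    have h1 : (rowList q).map (List.length ∘ ρ) = (rowList q).map fun a => a.1 :=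
      List.map_congr_left fun a _ => h.length_eq a
    rw [h1, ← List.sum_toFinset _ (nodup_rowList q)]
    have : (rowList q).toFinset = Finset.univ := by ext a; simp [mem_rowList]
    rw [this, sum_row_length]

/-- A word without repetitions that begins with its minimum. -/
def MinHead (l : List (Fin n)) : Prop := ∃ a t, l = a :: t ∧ t.Nodup ∧ ∀ x ∈ t, a < x

theorem MinHead.head_eq {a b : Fin n} {l u : List (Fin n)} (h : (a :: l).Perm (b :: u))
    (ha : MinHead (a :: l)) (hb : MinHead (b :: u)) : a = b := by
  obtain ⟨_, _, h1, -, hl⟩ := ha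
  obtain ⟨_, _, h2, -, hu⟩ := hb
  obtain ⟨rfl, rfl⟩ := List.cons.inj h1
  obtain ⟨rfl, rfl⟩ := List.cons.inj h2
  rcases List.mem_cons.1 (h.subset (List.mem_cons_self (a := a))) with h3 | h3
  · exact h3
  rcases List.mem_cons.1 (h.symm.subset (List.mem_cons_self (a := b))) with h4 | h4
  · exact h4.symm
  exact absurd (hl _ h4) (hu _ h3).asymm

theorem wordCoeff_bracketing_minHead {F : Type*} [Field F] {l u : List (Fin n)} (hl : MinHead l)
    (hu : MinHead u) : wordCoeff F u (bracketing F l) = if l = u then 1 else 0 := by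
  by_cases hp : u.Perm l
  · obtain ⟨a, l', rfl, hn, hl'⟩ := id hl
    obtain ⟨b, u', rfl, -, -⟩ := id hu
    obtain rfl := MinHead.head_eq hp hu hl
    rw [wordCoeff_bracketing_cons _ fun h => (hl' _ h).false]
    simp
  · rw [wordCoeff_bracketing_eq_zero hp, if_neg]
    rintro rfl
    exact hp (List.Perm.refl _)

/-- Every nonempty word without repetitions can be rotated so as to begin with its minimum. -/
theorem exists_minHead_rotate {l : List (Fin n)} (hl : l.Nodup) (hne : l ≠ []) :
    ∃ s < l.length, MinHead (l.rotate s) := by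
  obtain ⟨c, hc, hmin⟩ := l.toFinset.exists_min_image id (by simpa [Finset.nonempty_iff_ne_empty])
  rw [List.mem_toFinset] at hc
  obtain ⟨s, hs, rfl⟩ := List.getElem_of_mem hc
  refine ⟨s, hs, l[s], (l.rotate s).tail, ?_⟩
  have h1 : l.rotate s = l[s] :: (l.rotate s).tail := by
    rw [List.rotate_eq_drop_append_take hs.le, List.drop_eq_getElem_cons hs]
    rfl
  have h2 : (l[s] :: (l.rotate s).tail).Nodup := h1 ▸ (List.nodup_rotate.2 hl)
  refine ⟨h1, h2.of_cons, fun x hx => lt_of_le_of_ne (hmin x ?_) ?_⟩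
  · rw [List.mem_toFinset]
    exact (List.rotate_perm l s).subset (List.mem_of_mem_tail hx)
  · rintro rfl
    exact (List.nodup_cons.1 h2).1 hx

theorem MinHead.eq_of_rotate_eq {l u : List (Fin n)} (hl : MinHead l) (hu : MinHead u) {r s : ℕ}
    (h : l.rotate r = u.rotate s) : l = u := by
  have hp : l.Perm u := by
    have := (List.rotate_perm l r).symm
    rw [h] at this
    exact this.trans (List.rotate_perm u s)
  obtain ⟨a, l', rfl, hn, hl'⟩ := id hl
  obtain ⟨b, u', rfl, -, -⟩ := id hu
  obtain rfl := MinHead.head_eq hp hl hu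
  have hnd : (a :: l').Nodup := List.nodup_cons.2 ⟨fun h => (hl' _ h).false, hn⟩
  obtain ⟨t, ht⟩ : (a :: l') ~r (a :: u') :=
    (List.IsRotated.forall (a :: l') r).symm.trans (h ▸ List.IsRotated.forall (a :: u') s)
  rw [← List.rotate_mod] at ht
  have hlt : t % (a :: l').length < (a :: l').length := Nat.mod_lt _ (by simp)
  have h0 : (a :: l')[t % (a :: l').length] = (a :: l')[0] := by
    have := List.head?_rotate hlt
    rw [ht, List.getElem?_eq_getElem hlt, List.head?_cons, Option.some_inj] at this
    exact this.symm
  rw [(hnd.getElem_inj_iff).1 h0, List.rotate_zero] at ht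
  exact ht

/-- The row `T_{i,j}` of a tableau, as a word. -/
def Gamma.row (T : Gamma (partitionOf q)) (a : Row q) : List (Fin n) := List.ofFn (T.seq a.1 a.2)

theorem Gamma.isFilling (T : Gamma (partitionOf q)) : IsFilling T.row where
  length_eq a := List.length_ofFn
  cover x := by
    obtain ⟨i, j, k, h⟩ := T.cover x
    exact ⟨⟨i, j⟩, List.mem_ofFn.2 ⟨k, h⟩⟩

theorem Gamma.row_injective :
    Function.Injective (Gamma.row : Gamma (partitionOf q) → Row q → List (Fin n)) := by
  intro T T' h
  have : T.seq = T'.seq := by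
    funext i j
    exact List.ofFn_injective (congrFun h ⟨i, j⟩)
  cases T
  cases T'
  simpa using this

/-- The first entry of a row, which is its minimum. -/
def Gamma.first (T : Gamma (partitionOf q)) (a : Row q) : Fin n := T.seq a.1 a.2 ⟨0, a.pos⟩

theorem Gamma.row_eq_cons (T : Gamma (partitionOf q)) (a : Row q) :
    T.row a = T.first a :: (T.row a).tail := by
  have h : T.row a ≠ [] := by
    rw [← List.length_pos_iff, T.isFilling.length_eq]
    exact a.pos
  have h1 : (T.row a).head h = T.first a := by
    rw [List.head_eq_getElem]
    exact List.getElem_ofFn _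
  rw [← h1, List.cons_head_tail]

theorem Gamma.minHead (T : Gamma (partitionOf q)) (a : Row q) : MinHead (T.row a) := by
  have h := T.isFilling.nodup a
  rw [T.row_eq_cons] at h
  refine ⟨_, _, T.row_eq_cons a, h.of_cons, fun x hx => lt_of_le_of_ne ?_ ?_⟩
  · refine (T.min_first a.1 a.pos a.2).2 ?_
    have : x ∈ T.row a := List.mem_of_mem_tail hx
    exact List.mem_ofFn.1 this
  · rintro rfl
    exact (List.nodup_cons.1 h).1 hx

/-- The order condition on the minima leaves no freedom in the numbering of the rows. -/
theorem Gamma.eq_one_of_perm {T T' : Gamma (partitionOf q)} {h : Equiv.Perm (Row q)}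
    (hh : ∀ a, (T'.row a).Perm (T.row (h a))) : h = 1 := by
  have hfirst : ∀ a, T'.first a = T.first (h a) := by
    intro a
    have h1 := hh a
    have h2 := T'.minHead a
    have h3 := T.minHead (h a)
    rw [T'.row_eq_cons, T.row_eq_cons (h a)] at h1
    rw [T'.row_eq_cons] at h2
    rw [T.row_eq_cons (h a)] at h3
    exact MinHead.head_eq h1 h2 h3
  have hfst : ∀ a, (h a).1 = a.1 := by
    intro a
    rw [← T.isFilling.length_eq, ← T'.isFilling.length_eq, (hh a).length_eq]
  have hπ : ∀ i j, ∃ j', h ⟨i, j⟩ = ⟨i, j'⟩ := by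
    intro i j
    have := hfst ⟨i, j⟩
    generalize h ⟨i, j⟩ = b at this
    obtain ⟨i', j'⟩ := b
    obtain rfl : i' = i := this
    exact ⟨j', rfl⟩
  choose π hπ using hπ
  have hmono : ∀ i, StrictMono (π i) := by
    intro i j j' hjj
    have hi : 0 < i := Row.pos (q := q) ⟨i, j⟩
    have h1 : StrictMono fun j => T.seq i j ⟨0, hi⟩ := fun j j' => T.min_lt i hi j j'
    have h2 : ∀ j, T'.seq i j ⟨0, hi⟩ = T.seq i (π i j) ⟨0, hi⟩ := by
      intro j
      have := hfirst ⟨i, j⟩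
      rw [hπ] at this
      exact this
    rw [← h1.lt_iff_lt]
    simp only [← h2]
    exact T'.min_lt i hi j j' hjj
  have hid : ∀ i, π i = id := by
    intro i
    have h1 : Function.Surjective (π i) := Finite.injective_iff_surjective.1 (hmono i).injective
    exact (StrictMono.range_inj (hmono i) strictMono_id).1 (by rw [h1.range_eq, Set.range_id])
  ext1 ⟨i, j⟩
  rw [hπ, hid]
  rfl

/-- A filling whose rows begin with their minima becomes a tableau after renumbering its rows. -/
theorem exists_gamma {ρ : Row q → List (Fin n)} (hρ : IsFilling ρ) (hmin : ∀ a, MinHead (ρ a)) :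
    ∃ (T : Gamma (partitionOf q)) (h : Equiv.Perm (Row q)), ∀ a, T.row a = ρ (h a) := by
  let R : ∀ i (_ : Fin (mult (partitionOf q) i)), Fin i → Fin n := fun i j k =>
    (ρ ⟨i, j⟩).get (k.cast (hρ.length_eq ⟨i, j⟩).symm)
  have hR : ∀ i j, List.ofFn (R i j) = ρ ⟨i, j⟩ := by
    intro i j
    apply List.ext_getElem
    · simp [hρ.length_eq]
    · intro k h1 h2
      simp [R]
  have hleast : ∀ i (hi : 0 < i) j, IsLeast (Set.range (R i j)) (R i j ⟨0, hi⟩) := by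
    intro i hi j
    refine ⟨⟨_, rfl⟩, ?_⟩
    rintro _ ⟨k, rfl⟩
    obtain ⟨a, t, h1, -, h2⟩ := hmin ⟨i, j⟩
    have hk : R i j k ∈ a :: t := by
      rw [← h1, ← hR]
      exact List.mem_ofFn.2 ⟨k, rfl⟩
    have h0 : R i j ⟨0, hi⟩ = a := by
      simp [R, h1]
    rw [h0]
    rcases List.mem_cons.1 hk with h | h
    · exact h.ge
    · exact (h2 _ h).le
  let c : ∀ i, 0 < i → Fin (mult (partitionOf q) i) → Fin n := fun i hi j => R i j ⟨0, hi⟩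
  let σ : ∀ i, Equiv.Perm (Fin (mult (partitionOf q) i)) := fun i =>
    if hi : 0 < i then Tuple.sort (c i hi) else 1
  have hσ : ∀ i (hi : 0 < i), StrictMono fun j => R i (σ i j) ⟨0, hi⟩ := by
    intro i hi
    have h1 : Monotone (c i hi ∘ Tuple.sort (c i hi)) := Tuple.monotone_sort _
    have h2 : Function.Injective (c i hi) := by
      intro j j' hjj
      have := hρ.eq_of_mem (a := ⟨i, j⟩) (b := ⟨i, j'⟩) (x := c i hi j) (List.get_mem _ _)
        (by rw [hjj]; exact List.get_mem _ _)
      simpa using this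
    have h3 := h1.strictMono_of_injective (h2.comp (Tuple.sort (c i hi)).injective)
    have h4 : σ i = Tuple.sort (c i hi) := dif_pos hi
    rw [h4]
    exact h3
  refine ⟨⟨fun i j => R i (σ i j), fun x => ?_, fun i hi j => hleast i hi _, fun i hi j j' hjj =>
    hσ i hi hjj⟩, Equiv.sigmaCongrRight σ, fun a => hR a.1 (σ a.1 a.2)⟩
  obtain ⟨⟨i, j⟩, ha⟩ := hρ.cover x
  rw [← hR, List.mem_ofFn] at ha
  obtain ⟨k, hk⟩ := ha
  exact ⟨i, (σ i).symm j, k, by rw [Equiv.apply_symm_apply]; exact hk⟩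

end Tableaux

/-! ### The basis of the higher Lie module -/

section Basis

variable {F : Type*} [Field F] {n : ℕ} {q : Composition n}

theorem prod_bracketing_mem_span {X : Type*} (L : List (List X)) :
    (L.map (bracketing F)).prod ∈ Submodule.span F (word F '' {v | v.Perm L.flatten}) := by
  induction L with
  | nil => exact Submodule.subset_span ⟨[], by simp⟩
  | cons l L ih =>
    have := Submodule.mul_mem_mul (bracketing_mem_span_perm (F := F) l) ih
    rw [Submodule.span_mul_span] at this
    rw [List.map_cons, List.prod_cons]
    refine Submodule.span_mono ?_ this
    rintro _ ⟨_, ⟨u, hu, rfl⟩, _, ⟨v, hv, rfl⟩, rfl⟩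
    exact ⟨u ++ v, List.Perm.append hu hv, word_append u v⟩

theorem lieTableau_eq (T : Gamma (partitionOf q)) :
    lieTableau F T = toGroupAlg ((rowList q).map fun a => bracketing F (T.row a)).prod := by
  rw [lieTableau, rowList, List.map_flatMap]
  simp only [List.map_map, lieWord_eq]
  rfl

theorem toWords_lieTableau (T : Gamma (partitionOf q)) :
    toWords F n (lieTableau F T) = ((rowList q).map fun a => bracketing F (T.row a)).prod := by
  rw [lieTableau_eq, toWords_toGroupAlg]
  have h := prod_bracketing_mem_span (F := F) ((rowList q).map T.row)
  rw [List.map_map] at h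
  refine Submodule.span_mono (Set.image_mono fun v hv => ?_) h
  exact List.Perm.trans hv T.isFilling.flatten_perm

/-- The symmetrised product of the rows of a tableau: up to a factor, the element `ω_q Q_T`. -/
def symTableau (F : Type*) [Field F] (T : Gamma (partitionOf q)) : FreeAlg F (Fin n) :=
  symProd q.blocksFun (fun a : Row q => a.1) fun a => bracketing F (T.row a)

theorem toWords_higherWever_mul_lieTableau (T : Gamma (partitionOf q)) :
    toWords F n (higherWever F q * lieTableau F T)
      = (∏ j, (q.blocksFun j : F)) • symTableau F T := by
  rw [toWords_higherWever_mul, toWords_lieTableau]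
  have hlen : (rowList q).length = q.length := by
    have h1 := Fintype.card_congr ((nodup_rowList q).getEquivOfForallMemList _ mem_rowList)
    have h2 := Fintype.card_congr (rowEquiv q)
    rw [Fintype.card_fin] at h1 h2
    rw [h1, h2]
  let e : Fin q.length ≃ Row q := (finCongr hlen.symm).trans
    ((nodup_rowList q).getEquivOfForallMemList _ mem_rowList)
  have h1 : (rowList q).map (fun a => bracketing F (T.row a))
      = List.ofFn fun j => bracketing F (T.row (e j)) := by
    apply List.ext_getElem
    · simp [hlen]
    · intro i h1 h2
      simp [e]
  rw [h1, convBracketing_prod (r := fun j => T.row (e j)) fun j => q.one_le_blocksFun j]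
  · congr 1
    simp only [T.isFilling.length_eq]
    exact symProd_reindex q.blocksFun e (fun a : Row q => a.1) fun a => bracketing F (T.row a)
  · intro i h
    have := T.isFilling.length_eq (e i)
    rw [h] at this
    exact (e i).pos.ne this

/-- The coefficient at the word obtained by writing the rows of `T'` one after another separates
the elements `symTableau F T`. -/
theorem wordCoeff_symTableau [DecidableEq (Gamma (partitionOf q))] (T T' : Gamma (partitionOf q)) :
    wordCoeff F (List.ofFn fun j => T'.row (rowEquiv q j)).flatten (symTableau F T)
      = if T = T' then 1 else 0 := by
  have key : ∀ f : Fin q.length ≃ Row q, (∀ j, (f j).1 = q.blocksFun j) →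
      wordCoeff F (List.ofFn fun j => T'.row (rowEquiv q j)).flatten
        (List.ofFn fun j => bracketing F (T.row (f j))).prod
      = ∏ j, if T.row (f j) = T'.row (rowEquiv q j) then 1 else 0 := by
    intro f hf
    rw [List.ofFn_eq_map, List.ofFn_eq_map, wordCoeff_flatten_prod, ← List.ofFn_eq_map,
      List.prod_ofFn]
    · exact Finset.prod_congr rfl fun j _ =>
        wordCoeff_bracketing_minHead (T.minHead _) (T'.minHead _)
    · intro j _
      have := bracketing_mem_span_length (F := F) (T.row (f j))
      rwa [T.isFilling.length_eq, hf, ← rowEquiv_fst, ← T'.isFilling.length_eq] at this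
  -- equality of all rows forces the two numberings of the rows to agree
  have hrow : ∀ f : Fin q.length ≃ Row q, (∀ j, T.row (f j) = T'.row (rowEquiv q j)) →
      f = rowEquiv q ∧ T = T' := by
    intro f hf
    have h1 : (rowEquiv q).symm.trans f = 1 := by
      refine Gamma.eq_one_of_perm (T := T) (T' := T') fun a => ?_
      have := hf ((rowEquiv q).symm a)
      rw [Equiv.apply_symm_apply] at this
      rw [← this]
      exact List.Perm.refl _
    have h2 : f = rowEquiv q := by
      ext1 j
      have := DFunLike.congr_fun h1 (rowEquiv q j)
      simpa using this
    refine ⟨h2, Gamma.row_injective ?_⟩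
    funext a
    have := hf ((rowEquiv q).symm a)
    rwa [h2, Equiv.apply_symm_apply] at this
  rw [symTableau, symProd_apply, map_sum, Finset.sum_congr rfl fun f hf =>
    key f (Finset.mem_filter.1 hf).2]
  split_ifs with h
  · subst h
    rw [Finset.sum_eq_single (rowEquiv q)]
    · simp
    · intro f _ hne
      by_contra hcon
      refine hne (hrow f fun j => ?_).1
      by_contra hj
      exact hcon (Finset.prod_eq_zero (Finset.mem_univ j) (if_neg hj))
    · intro h
      exact absurd (Finset.mem_filter.2 ⟨Finset.mem_univ _, fun j => rfl⟩) h
  · refine Finset.sum_eq_zero fun f _ => ?_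
    by_contra hcon
    refine h (hrow f fun j => ?_).2
    by_contra hj
    exact hcon (Finset.prod_eq_zero (Finset.mem_univ j) (if_neg hj))

theorem linearIndependent_symTableau :
    LinearIndependent F (symTableau F : Gamma (partitionOf q) → FreeAlg F (Fin n)) := by
  classical
  refine LinearIndependent.of_pairwise_dual_eq_zero_one _
    (fun T' => wordCoeff F (List.ofFn fun j => T'.row (rowEquiv q j)).flatten) ?_ ?_
  · intro T' T hne
    simp [wordCoeff_symTableau, hne.symm]
  · intro T
    simp [wordCoeff_symTableau]

/-- The symmetrised product of words beginning with their minima, if it does not vanish for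
reasons of degree, comes from a tableau. -/
theorem symProd_minHead_mem {u : Fin q.length → List (Fin n)} (hu : ∀ i, MinHead (u i))
    (hcover : ∀ x, ∃ i, x ∈ u i) :
    symProd q.blocksFun (fun i => (u i).length) (fun i => bracketing F (u i)) ∈
      Submodule.span F (Set.range (symTableau F : Gamma (partitionOf q) → _)) := by
  by_cases hf : ∃ f : Fin q.length ≃ Fin q.length, ∀ j, (u (f j)).length = q.blocksFun j
  · obtain ⟨f, hf⟩ := hf
    let e : Row q ≃ Fin q.length := (rowEquiv q).symm.trans f
    have hfill : IsFilling fun a : Row q => u (e a) := by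
      refine ⟨fun a => ?_, fun x => ?_⟩
      · rw [← (rowEquiv q).apply_symm_apply a, rowEquiv_fst, ← hf]
        simp [e]
      · obtain ⟨i, hi⟩ := hcover x
        exact ⟨e.symm i, by simpa using hi⟩
    obtain ⟨T, h, hT⟩ := exists_gamma hfill fun a => hu _
    refine Submodule.subset_span ⟨T, ?_⟩
    rw [symTableau, ← symProd_reindex q.blocksFun (h.trans e) (fun i => (u i).length)]
    have h1 : ∀ a, (u (h.trans e a)).length = a.1 := fun a => by
      rw [← T.isFilling.length_eq, hT]
      rfl
    simp only [h1, hT]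
    rfl
  · rw [symProd_apply, Finset.filter_false_of_mem, Finset.sum_empty]
    · exact Submodule.zero_mem _
    · exact fun f _ h => hf ⟨f, h⟩

/-- The spanning property: the values of `ω_q` at permutations are combinations of the symmetrised
products of tableaux. -/
theorem convBracketing_perm_mem (σ : Sym n) :
    convBracketing F (Fin n) q.blocksFun (word F (List.ofFn (app σ))) ∈
      Submodule.span F (Set.range (symTableau F : Gamma (partitionOf q) → _)) := by
  refine Submodule.span_le.2 ?_ (convBracketing_word_mem (fun j => q.one_le_blocksFun j) (app σ))
  rintro _ ⟨r, ⟨hne, hperm⟩, rfl⟩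
  have hnodup : (List.ofFn r).flatten.Nodup :=
    hperm.nodup_iff.2 (List.nodup_ofFn.2 σ.unop.injective)
  have hr : ∀ i, (r i).Nodup := fun i =>
    (List.nodup_flatten.1 hnodup).1 _ (List.mem_ofFn.2 ⟨i, rfl⟩)
  have hcover : ∀ x, ∃ i, x ∈ r i := by
    intro x
    have : x ∈ (List.ofFn r).flatten :=
      hperm.symm.subset (List.mem_ofFn.2 ⟨σ.unop.symm x, σ.unop.apply_symm_apply x⟩)
    obtain ⟨l, hl, hx⟩ := List.mem_flatten.1 this
    obtain ⟨i, rfl⟩ := List.mem_ofFn.1 hl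
    exact ⟨i, hx⟩
  choose a ha hamin using fun i => (r i).toFinset.exists_min_image id
    (by simpa [Finset.nonempty_iff_ne_empty] using hne i)
  simp only [List.mem_toFinset] at ha hamin
  refine multilinear_apply_mem_of_mem_span _ ?_ fun i => bracketing_mem_span_head (F := F) (ha i)
  intro v hv
  choose u hu using hv
  have hv' : v = fun i => bracketing F (a i :: u i) := funext fun i => (hu i).2.symm
  have hp : ∀ i, (a i :: u i).Perm (r i) := fun i => (hu i).1
  have hlen : ∀ i, (r i).length = (a i :: u i).length := fun i => (hp i).length_eq.symm
  subst hv'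
  simp only [hlen]
  refine symProd_minHead_mem (fun i => ?_) fun x => ?_
  · have hn : (a i :: u i).Nodup := (hp i).nodup_iff.2 (hr i)
    refine ⟨_, _, rfl, hn.of_cons, fun x hx => lt_of_le_of_ne ?_ ?_⟩
    · exact hamin i x ((hp i).subset (List.mem_cons_of_mem _ hx))
    · rintro rfl
      exact (List.nodup_cons.1 hn).1 hx
  · obtain ⟨i, hi⟩ := hcover x
    exact ⟨i, (hp i).symm.subset hi⟩

theorem toWords_higherWever_mul_mem (x : GroupAlg F n) :
    toWords F n (higherWever F q * x) ∈
      Submodule.span F (Set.range (symTableau F : Gamma (partitionOf q) → _)) := by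
  induction x using MonoidAlgebra.induction_linear with
  | zero => simp
  | add x y hx hy => rw [mul_add, map_add]; exact Submodule.add_mem _ hx hy
  | single σ c =>
    have : (MonoidAlgebra.single σ c : GroupAlg F n) = c • MonoidAlgebra.single σ 1 := by simp
    rw [this, mul_smul_comm, map_smul, toWords_higherWever_mul, toWords_single]
    exact Submodule.smul_mem _ _ (convBracketing_perm_mem σ)

theorem prod_blocksFun_ne_zero {p : ℕ} [CharP F p] (hq : IsCoprimeTo q p) :
    (∏ j, (q.blocksFun j : F)) ≠ 0 := by
  rw [Finset.prod_ne_zero_iff]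
  intro j _ h
  exact hq _ (q.blocksFun_mem_blocks j) ((CharP.cast_eq_zero_iff F p _).1 h)

/-- The inclusion of the higher Lie module into the algebra of words. -/
def lieModuleToWords (F : Type*) [Field F] (q : Composition n) :
    lieModule F q →ₗ[F] FreeAlg F (Fin n) :=
  toWords F n ∘ₗ (lieModule F q).subtype.restrictScalars F

theorem lieModuleToWords_injective : Function.Injective (lieModuleToWords F q) :=
  (toWords_injective n).comp Subtype.val_injective

/-- The elements `ω_q Q_T`. -/
def lieVector (F : Type*) [Field F] {q : Composition n} (T : Gamma (partitionOf q)) :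
    lieModule F q :=
  ⟨higherWever F q * lieTableau F T,
    Submodule.mem_span_singleton.2 ⟨MulOpposite.op (lieTableau F T), rfl⟩⟩

theorem lieModuleToWords_lieVector (T : Gamma (partitionOf q)) :
    lieModuleToWords F q (lieVector F T) = (∏ j, (q.blocksFun j : F)) • symTableau F T :=
  toWords_higherWever_mul_lieTableau T

theorem linearIndependent_lieVector {p : ℕ} [CharP F p] (hq : IsCoprimeTo q p) :
    LinearIndependent F (lieVector F : Gamma (partitionOf q) → lieModule F q) := by
  refine LinearIndependent.of_comp (lieModuleToWords F q) ?_
  have := (linearIndependent_symTableau (F := F) (q := q)).units_smul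
    fun _ => Units.mk0 _ (prod_blocksFun_ne_zero (F := F) hq)
  convert this using 1
  funext T
  exact lieModuleToWords_lieVector T

theorem top_le_span_lieVector {p : ℕ} [CharP F p] (hq : IsCoprimeTo q p) :
    ⊤ ≤ Submodule.span F (Set.range (lieVector F : Gamma (partitionOf q) → lieModule F q)) := by
  rintro ⟨y, hy⟩ -
  obtain ⟨x, rfl⟩ := Submodule.mem_span_singleton.1 hy
  have h1 : lieModuleToWords F q ⟨_, hy⟩ ∈
      Submodule.span F (Set.range (symTableau F : Gamma (partitionOf q) → _)) :=
    toWords_higherWever_mul_mem x.unop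
  have h2 : Submodule.span F (Set.range (symTableau F : Gamma (partitionOf q) → _)) ≤
      (Submodule.span F (Set.range (lieVector F : Gamma (partitionOf q) → lieModule F q))).map
        (lieModuleToWords F q) := by
    rw [Submodule.map_span, Submodule.span_le]
    rintro _ ⟨T, rfl⟩
    have h3 : symTableau F T = (∏ j, (q.blocksFun j : F))⁻¹ •
        lieModuleToWords F q (lieVector F T) := by
      rw [lieModuleToWords_lieVector, inv_smul_smul₀ (prod_blocksFun_ne_zero hq)]
    rw [h3]
    exact Submodule.smul_mem _ _ (Submodule.subset_span ⟨_, ⟨T, rfl⟩, rfl⟩)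
  obtain ⟨z, hz, hzy⟩ := h2 h1
  rwa [lieModuleToWords_injective hzy] at hz

end Basis

/-! ### Counting tableaux and conjugacy classes -/

section Counting

variable {n : ℕ} {q : Composition n}

theorem card_isFilling (q : Composition n) :
    Nat.card {ρ : Row q → List (Fin n) // IsFilling ρ} = n.factorial := by
  let Φ : ((Σ a : Row q, Fin a.1) ≃ Fin n) → {ρ : Row q → List (Fin n) // IsFilling ρ} := fun φ =>
    ⟨fun a => List.ofFn fun k => φ ⟨a, k⟩, fun a => List.length_ofFn, fun x =>
      ⟨(φ.symm x).1, List.mem_ofFn.2 ⟨(φ.symm x).2, φ.apply_symm_apply x⟩⟩⟩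
  have hΦ : Function.Bijective Φ := by
    constructor
    · intro φ φ' h
      ext1 ⟨a, k⟩
      have := congrFun (congrArg Subtype.val h) a
      exact congrFun (List.ofFn_injective this) k
    · rintro ⟨ρ, hρ⟩
      refine ⟨Equiv.ofBijective _ hρ.bijective, Subtype.ext (funext fun a => ?_)⟩
      apply List.ext_getElem
      · simp [Φ, hρ.length_eq]
      · intro i h1 h2
        simp [Φ]
  rw [← Nat.card_congr (Equiv.ofBijective Φ hΦ), Nat.card_eq_fintype_card,
    Fintype.card_equiv (Fintype.equivFinOfCardEq (card_cells q)), card_cells]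

/-- Every filling arises from exactly one tableau by renumbering rows of equal length and rotating
each row. -/
theorem card_gamma_mul (q : Composition n) :
    Nat.card (Gamma (partitionOf q)) *
      (Nat.card {h : Equiv.Perm (Row q) // Sigma.fst ∘ h = Sigma.fst} * Nat.card (∀ a : Row q, Fin a.1)) = n.factorial := by
  rw [← card_isFilling q, ← Nat.card_prod, ← Nat.card_prod]
  let Φ : (Gamma (partitionOf q) × {h : Equiv.Perm (Row q) // Sigma.fst ∘ h = Sigma.fst} ×
      ∀ a : Row q, Fin a.1) → {ρ : Row q → List (Fin n) // IsFilling ρ} := fun x =>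
    ⟨fun a => (x.1.row (x.2.1.1 a)).rotate (x.2.2 a), fun a => by
      rw [List.length_rotate, x.1.isFilling.length_eq]
      exact congrFun x.2.1.2 a, fun y => by
      obtain ⟨a, ha⟩ := x.1.isFilling.cover y
      exact ⟨x.2.1.1.symm a, by simpa using ha⟩⟩
  refine Nat.card_congr (Equiv.ofBijective Φ ⟨?_, ?_⟩)
  · rintro ⟨T, ⟨h, hh⟩, r⟩ ⟨T', ⟨h', hh'⟩, r'⟩ heq
    have h1 : ∀ a, (T.row (h a)).rotate (r a) = (T'.row (h' a)).rotate (r' a) :=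
      congrFun (congrArg Subtype.val heq)
    have h2 : ∀ a, T.row (h a) = T'.row (h' a) := fun a =>
      MinHead.eq_of_rotate_eq (T.minHead _) (T'.minHead _) (h1 a)
    have h3 : h'.symm.trans h = 1 := by
      refine Gamma.eq_one_of_perm (T := T) (T' := T') fun a => ?_
      have := h2 (h'.symm a)
      rw [Equiv.apply_symm_apply] at this
      rw [← this]
      exact List.Perm.refl _
    obtain rfl : h = h' := by
      ext1 a
      have := DFunLike.congr_fun h3 (h' a)
      simpa using this
    obtain rfl : T = T' := Gamma.row_injective (by
      funext a
      simpa using h2 (h.symm a))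
    obtain rfl : r = r' := by
      funext a
      have hlen : (T.row (h a)).length = a.1 := (T.isFilling.length_eq _).trans (congrFun hh a)
      have hne : T.row (h a) ≠ [] := by
        rw [← List.length_pos_iff, hlen]
        exact a.pos
      have := (T.isFilling.nodup (h a)).rotate_congr hne _ _ (h1 a)
      rw [hlen, Nat.mod_eq_of_lt (r a).isLt, Nat.mod_eq_of_lt (r' a).isLt] at this
      exact Fin.ext this
    rfl
  · rintro ⟨ρ, hρ⟩
    have hrot : ∀ a, ∃ s < (ρ a).length, MinHead ((ρ a).rotate s) := fun a => by
      refine exists_minHead_rotate (hρ.nodup a) ?_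
      rw [← List.length_pos_iff, hρ.length_eq]
      exact a.pos
    choose s hs hmin using hrot
    have hfill : IsFilling fun a => (ρ a).rotate (s a) :=
      ⟨fun a => by rw [List.length_rotate, hρ.length_eq], fun x => by simpa using hρ.cover x⟩
    obtain ⟨T, h, hT⟩ := exists_gamma hfill hmin
    have hfst : ∀ a, (h a).1 = a.1 := fun a => by
      rw [← hfill.length_eq, ← hT, T.isFilling.length_eq]
    refine ⟨⟨T, ⟨h.symm, ?_⟩, fun a => ⟨(a.1 - s a) % a.1, Nat.mod_lt _ a.pos⟩⟩,
      Subtype.ext (funext fun a => ?_)⟩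
    · funext a
      have := hfst (h.symm a)
      rw [Equiv.apply_symm_apply] at this
      exact this.symm
    · change (T.row (h.symm a)).rotate ((a.1 - s a) % a.1) = ρ a
      have hsa := hs a
      rw [hT, Equiv.apply_symm_apply, List.rotate_rotate, ← List.rotate_mod, hρ.length_eq]
      rw [hρ.length_eq] at hsa
      rw [Nat.add_mod_mod, Nat.add_sub_cancel' hsa.le, Nat.mod_self, List.rotate_zero]

theorem card_row_fst_eq (q : Composition n) (i : ℕ) :
    Fintype.card {a : Row q // a.1 = i} = mult (partitionOf q) i := by
  rw [← card_blocksFun_eq]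
  exact (Fintype.card_congr ((rowEquiv q).subtypeEquiv fun j => Iff.rfl)).symm

theorem mult_partitionOf (q : Composition n) (i : ℕ) :
    mult (partitionOf q) i = q.blocks.count i :=
  Multiset.coe_count i q.blocks

theorem card_symmetries (q : Composition n) :
    Nat.card {h : Equiv.Perm (Row q) // Sigma.fst ∘ h = Sigma.fst}
      * Nat.card (∀ a : Row q, Fin a.1) = qMark q := by
  rw [Nat.card_eq_fintype_card, DomMulAct.stabilizer_card', Nat.card_pi]
  simp only [Nat.card_eq_fintype_card, Fintype.card_fin]
  rw [← Finset.prod_fiberwise_of_maps_to fun (a : Row q) _ => row_fst_mem a, qMark,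
    Finset.prod_mul_distrib, mul_comm]
  congr 1
  · refine Finset.prod_congr rfl fun i _ => ?_
    rw [Finset.prod_congr rfl fun a ha => (Finset.mem_filter.1 ha).2, Finset.prod_const,
      ← Fintype.card_subtype, card_row_fst_eq, mult_partitionOf]
  · rw [Finset.prod_subset (s₂ := Finset.Icc 1 n)]
    · exact Finset.prod_congr rfl fun i _ => by rw [card_row_fst_eq, mult_partitionOf]
    · intro i hi
      obtain ⟨a, -, rfl⟩ := Finset.mem_image.1 hi
      exact row_fst_mem a
    · intro i _ hi
      have : IsEmpty {a : Row q // a.1 = i} :=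
        ⟨fun a => hi (Finset.mem_image.2 ⟨a.1, Finset.mem_univ _, a.2⟩)⟩
      rw [Fintype.card_eq_zero, Nat.factorial_zero]

/-- The parts of size at least `2`: the lengths of the nontrivial cycles. -/
def largeParts (μ : Nat.Partition n) : Multiset ℕ := μ.parts.filter fun i => 2 ≤ i

theorem parts_eq_largeParts_add (μ : Nat.Partition n) :
    μ.parts = largeParts μ + Multiset.replicate (mult μ 1) 1 := by
  conv_lhs => rw [← Multiset.filter_add_not (fun i => 2 ≤ i) μ.parts]
  rw [largeParts, mult, ← Multiset.filter_eq' μ.parts 1]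
  congr 1
  refine Multiset.filter_congr fun i hi => ?_
  have := μ.parts_pos hi
  omega

theorem sum_largeParts_add (μ : Nat.Partition n) : (largeParts μ).sum + mult μ 1 = n := by
  have := congrArg Multiset.sum (parts_eq_largeParts_add μ)
  rw [μ.parts_sum, Multiset.sum_add, Multiset.sum_replicate, smul_eq_mul, mul_one] at this
  exact this.symm

theorem mem_conjClass_iff (μ : Nat.Partition n) (σ : Equiv.Perm (Fin n)) :
    σ ∈ conjClass μ ↔ σ.cycleType = largeParts μ := by
  constructor
  · intro h
    have h : σ.partition.parts = μ.parts := h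
    rw [← Equiv.Perm.filter_parts_partition_eq_cycleType, h]
    rfl
  · intro h
    change σ.partition.parts = μ.parts
    have h1 := sum_largeParts_add μ
    rw [Equiv.Perm.parts_partition, parts_eq_largeParts_add μ, ← Equiv.Perm.sum_cycleType, h,
      Fintype.card_fin]
    congr 2
    omega

theorem qMark_eq (q : Composition n) : qMark q =
    (n - (largeParts (partitionOf q)).sum).factorial * (largeParts (partitionOf q)).prod *
      ∏ i ∈ (largeParts (partitionOf q)).toFinset,
        ((largeParts (partitionOf q)).count i).factorial := by
  set μ := partitionOf q
  have hsum := sum_largeParts_add μ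
  have hle : ∀ i ∈ μ.parts, i ≤ n := fun i hi =>
    (Multiset.single_le_sum (fun _ _ => Nat.zero_le _) i hi).trans_eq μ.parts_sum
  have hzero : ∀ i, i ∉ μ.parts → i ^ mult μ i * (mult μ i).factorial = 1 := by
    intro i hi
    rw [mult, Multiset.count_eq_zero_of_notMem hi]
    simp
  have h1 : qMark q = ∏ i ∈ Finset.range (n + 2), i ^ mult μ i * (mult μ i).factorial := by
    simp only [qMark, ← mult_partitionOf]
    refine Finset.prod_subset (fun i hi => ?_) fun i _ hi => hzero i fun h => hi ?_
    · simp only [Finset.mem_Icc, Finset.mem_range] at hi ⊢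
      omega
    · exact Finset.mem_Icc.2 ⟨μ.parts_pos h, hle i h⟩
  have h2 : ∏ i ∈ insert 1 (largeParts μ).toFinset, i ^ mult μ i * (mult μ i).factorial
      = ∏ i ∈ Finset.range (n + 2), i ^ mult μ i * (mult μ i).factorial := by
    refine Finset.prod_subset (fun i hi => ?_) fun i _ hi => hzero i fun h => hi ?_
    · rcases Finset.mem_insert.1 hi with rfl | hi
      · simp
      · have := hle i (Multiset.mem_of_mem_filter (Multiset.mem_toFinset.1 hi))
        simp only [Finset.mem_range]
        omega
    · have := μ.parts_pos h
      rcases Nat.lt_or_ge i 2 with h3 | h3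
      · exact Finset.mem_insert.2 (Or.inl (by omega))
      · exact Finset.mem_insert_of_mem (Multiset.mem_toFinset.2 (Multiset.mem_filter.2 ⟨h, h3⟩))
  have h3 : 1 ∉ (largeParts μ).toFinset := by
    simp [largeParts]
  have h4 : ∀ i ∈ (largeParts μ).toFinset, mult μ i = (largeParts μ).count i := by
    intro i hi
    have : 2 ≤ i := (Multiset.mem_filter.1 (Multiset.mem_toFinset.1 hi)).2
    rw [largeParts, Multiset.count_filter_of_pos this, mult]
  have h5 : n - (largeParts μ).sum = mult μ 1 := by omega
  rw [h1, ← h2, Finset.prod_insert h3, h5, Finset.prod_multiset_count (largeParts μ), one_pow,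
    one_mul, mul_assoc, ← Finset.prod_mul_distrib]
  congr 1
  exact Finset.prod_congr rfl fun i hi => by rw [h4 i hi]

theorem ncard_conjClass_mul (q : Composition n) :
    (conjClass (partitionOf q)).ncard * qMark q = n.factorial := by
  have h := Equiv.Perm.card_of_cycleType_mul_eq (Fin n) (largeParts (partitionOf q))
  have hsum := sum_largeParts_add (partitionOf q)
  rw [Fintype.card_fin, ← qMark_eq,
    if_pos ⟨by omega, fun a ha => (Multiset.mem_filter.1 ha).2⟩] at h
  rw [← h, ← Set.ncard_coe_finset]
  congr 2
  ext σ
  simp [mem_conjClass_iff]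

theorem card_gamma_mul_qMark (q : Composition n) :
    Nat.card (Gamma (partitionOf q)) * qMark q = n.factorial := by
  rw [← card_symmetries, card_gamma_mul]

theorem qMark_pos (q : Composition n) : 0 < qMark q :=
  Nat.pos_of_ne_zero fun h => n.factorial_ne_zero (by rw [← card_gamma_mul_qMark q, h, mul_zero])

end Counting

end

end HigherLie

theorem theoremT {F : Type*} [Field F] {p : ℕ} [CharP F p] {n : ℕ} (q : Composition n)
    (hq : HigherLie.IsCoprimeTo q p) :
    (∃ b : Module.Basis (HigherLie.Gamma (HigherLie.partitionOf q)) F (HigherLie.lieModule F q),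
      ∀ T, (b T : HigherLie.GroupAlg F n) =
        HigherLie.higherWever F q * HigherLie.lieTableau F T) ∧
    Module.finrank F (HigherLie.lieModule F q) =
      (HigherLie.conjClass (HigherLie.partitionOf q)).ncard ∧
    (Module.finrank F (HigherLie.lieModule F q) : ℚ) =
      (n.factorial : ℚ) / (HigherLie.qMark q : ℚ) := by
  let b : Module.Basis (HigherLie.Gamma (HigherLie.partitionOf q)) F (HigherLie.lieModule F q) :=
    Module.Basis.mk (HigherLie.linearIndependent_lieVector hq) (HigherLie.top_le_span_lieVector hq)
  have hpos := HigherLie.qMark_pos q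
  have hrank : Module.finrank F (HigherLie.lieModule F q)
      = Nat.card (HigherLie.Gamma (HigherLie.partitionOf q)) := Module.finrank_eq_nat_card_basis b
  refine ⟨⟨b, fun T => ?_⟩, ?_, ?_⟩
  · rw [Module.Basis.mk_apply]
    rfl
  · rw [hrank]
    exact Nat.eq_of_mul_eq_mul_right hpos
      ((HigherLie.card_gamma_mul_qMark q).trans (HigherLie.ncard_conjClass_mul q).symm)
  · rw [hrank, eq_div_iff (by exact_mod_cast hpos.ne')]
    exact_mod_cast HigherLie.card_gamma_mul_qMark q
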